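/- **Definitions.** For $\rho>0$ let $B_c(0,\rho)\subset\mathbb C^n\cong\mathbb R^{2n}$ be the open complex Euclidean ball of radius $\rho$ centered at $0$. For $r>1$ and $f$ holomorphic on $B_c(0,r)$, the *Chebyshev degree* $d_f(r)\in[0,\infty]$ is the infimum of all real $d\ge 0$ such that $$\sup_I|f|\le\Bigl(\frac{4|I|}{|\omega|}\Bigr)^{d}\sup_\omega|f|$$ for every real segment $I\subset B_c(0,1)$ and every measurable $\omega\subset I$ of positive length $|\omega|$ (it is known that $d_f(r)<\infty$). A function $h:\mathbb R^k\to[0,\infty)$ is *log-concave* if $K=\{h>0\}$ is convex and $\log h$ is concave on $K$; $\mu_h$ denotes the measure on $\mathbb R^k$ with density $h$. **Statement.** There is an absolute constant $c>0$ (independent of all the data below, in particular of the dimensions $k,n$) such that the following holds. Let $\mathbb R^k\subset\mathbb C^n$ be a $k$-dimensional real affine subspace, $V\subset B_c(0,1)\cap\mathbb R^k$ a $k$-dimensional convex body (compact, convex, with non-empty interior in $\mathbb R^k$), $h:\mathbb R^k\to[0,\infty)$ a log-concave function vanishing outside $V$ with $0<|V|:=\mu_h(V)<\infty$, $r>1$,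 and $f$ holomorphic on $B_c(0,r)$. Put $$f_V:=\exp\Bigl(\frac1{|V|}\int_V\log|f|\,d\mu_h\Bigr)$$ (with $f_V=0$ if the integral is $-\infty$). Then for every real $p>1$ and every real $d\ge d_f(r)$, in particular for $d=d_f(r)$, $$\frac1{|V|}\int_V|f|^p\,d\mu_h\le\bigl(c\max\{1,pd\}\bigr)^{pd}\,(f_V)^p\le\bigl(c\max\{1,pd\}\bigr)^{pd}\Bigl(\frac1{|V|}\int_V|f|\,d\mu_h\Bigr)^p .$$ -/

import Mathlib

open MeasureTheory
open scoped NNReal ENNReal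

noncomputable section

/-- `d` is an admissible exponent for `f` on the open unit ball of `ℂⁿ`: for every real segment
`I = [a, b]` in the ball and every measurable `ω ⊆ I` of positive length,
`sup_I |f| ≤ (4 |I| / |ω|) ^ d * sup_ω |f|`.
The segment is parametrized by `t ∈ [0, 1] ↦ a + t (b - a)` and `ω` is the image of
`E ⊆ [0, 1]`; this map multiplies lengths by `|I|`, hence `|I| / |ω| = 1 / volume E`.
(For `a = b` the inequality holds trivially.) -/
def IsRemezExponent {n : ℕ} (f : EuclideanSpace ℂ (Fin n) → ℂ) (d : ℝ≥0) : Prop :=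
  ∀ a ∈ Metric.ball (0 : EuclideanSpace ℂ (Fin n)) 1,
  ∀ b ∈ Metric.ball (0 : EuclideanSpace ℂ (Fin n)) 1,
  ∀ E : Set ℝ, E ⊆ Set.Icc 0 1 → MeasurableSet E → volume E ≠ 0 →
    (⨆ t ∈ Set.Icc (0 : ℝ) 1, ‖f (AffineMap.lineMap a b t)‖ₑ) ≤
      (4 / volume E) ^ (d : ℝ) * ⨆ t ∈ E, ‖f (AffineMap.lineMap a b t)‖ₑ

/-- The Chebyshev degree of `f` in the unit ball: the optimal exponent in the inequality above,
as an element of `[0, ∞]`. It involves only the values of `f` on the unit ball; the radius `r`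
of the larger ball on which `f` is holomorphic does not enter. -/
def chebyshevDegree {n : ℕ} (f : EuclideanSpace ℂ (Fin n) → ℂ) : ℝ≥0∞ :=
  ⨅ (d : ℝ≥0) (_ : IsRemezExponent f d), (d : ℝ≥0∞)

/-- A function `h : ℝᵏ → [0, ∞)` is log-concave if `K = {h > 0}` is convex and `log h` is
concave on `K`. (Convexity of `K` is part of `ConcaveOn`.) -/
def IsLogConcave {k : ℕ} (h : EuclideanSpace ℝ (Fin k) → ℝ≥0) : Prop :=
  ConcaveOn ℝ {x | 0 < h x} fun x => Real.log (h x)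

/-- The measure `μ_h` on `ℝᵏ` with density `h` with respect to Lebesgue measure. -/
def densityMeasure {k : ℕ} (h : EuclideanSpace ℝ (Fin k) → ℝ≥0) :
    Measure (EuclideanSpace ℝ (Fin k)) :=
  volume.withDensity fun x => (h x : ℝ≥0∞)

/-- The geometric mean `exp ((1 / μ(V)) ∫_V log |g| dμ)`. The integral of `log |g|` (with
`log 0 = -∞`) is the difference of the integrals of its positive and negative parts, so that the
geometric mean is `0` if the integral of `log |g|` is `-∞`. -/
def geomMean {α : Type*} [MeasurableSpace α] (μ : Measure α) (V : Set α) (g : α → ℂ) : ℝ≥0∞ :=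
  EReal.exp
    (((⨍⁻ x in V, (ENNReal.log ‖g x‖ₑ).toENNReal ∂μ : ℝ≥0∞) : EReal) -
      ((⨍⁻ x in V, (-ENNReal.log ‖g x‖ₑ).toENNReal ∂μ : ℝ≥0∞) : EReal))

end

open MeasureTheory Set Filter Topology
open scoped NNReal ENNReal

noncomputable section

/-! For `g = |f|^(1/d)` the Remez inequality becomes linear: a segment starting at `x` spends at
most the fraction `4b / g x` of its length in `{g ≤ b}`. Under the normalized log-concave measure
`P`, the `L^(pd)` norm and the geometric mean of `g` are each compared with its upper quartile `a`,
with dimension-free constants.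

The dimension-free tool is a Prékopa–Leindler inequality. The pointwise form does not fit, since the
Remez inequality controls only the proportion of bad points on a segment; the lower bound is
therefore assumed on average over the interpolation parameter `t`. The transport proof survives: one
monotone coupling serves all `t`, Fubini exchanges the integrals, and the result tensorizes.

Averaging over `t ∈ [1 - η, 1]` gives `measure_rpow_le`: `(η - δ) P(U)^η ≤ η P(Aᶜ)` if segments from
`U` spend at most `δ` in `A`. With `U = {g > j a}`, `A = {g ≤ a}` it yields an exponential upper
tail, hence `∫ g^s ≤ (C s a)^s`. With `U = {g ≥ a}`, `A = {g ≤ 4⁻ʲ a}` it yields `P(A) ≤ 6 · 2⁻ʲ`,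
which bounds the mean of `log (a / g)` from above. Together they give the theorem with `c = 4^12 C`.
-/

/-! ### Quantile transport and the averaged Prékopa–Leindler inequality -/

/-- `Q` is the generalized inverse of the distribution function `F`. Since `F` is continuous, `F (Q
s) = s` even if `Q` jumps, and the chain rule gives `F' (Q s) * Q' s = 1` for a.e. `s`. That `F'` is
the density holds only `P`-a.e.; it transfers to a.e. `s` because `Q` pushes Lebesgue measure on
`(0, 1)` to `P`. -/
theorem exists_quantile_density {u : ℝ → ℝ≥0∞} (hu : Measurable u) (h0 : ∫⁻ x, u x ≠ 0)
    (h1 : ∫⁻ x, u x ≠ ∞) :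
    ∃ Q q : ℝ → ℝ, Measurable Q ∧ MonotoneOn Q (Ioo 0 1) ∧
      ∀ᵐ s ∂volume.restrict (Ioo (0 : ℝ) 1),
        HasDerivAt Q (q s) s ∧ 0 < q s ∧ u (Q s) * ENNReal.ofReal (q s) = ∫⁻ x, u x := by
  set I := ∫⁻ x, u x with hI
  set f : ℝ → ℝ≥0∞ := fun x => I⁻¹ * u x with hf
  have hfm : Measurable f := hu.const_mul _
  set P : Measure ℝ := volume.withDensity f with hP
  have : IsProbabilityMeasure P := ⟨by
    rw [hP, withDensity_apply _ MeasurableSet.univ, Measure.restrict_univ, lintegral_const_mul _ hu,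
      ← hI, ENNReal.inv_mul_cancel h0 h1]⟩
  set F := ProbabilityTheory.cdf P with hF
  have hFmono : Monotone F := ProbabilityTheory.monotone_cdf P
  have hFcont : Continuous F := by
    refine continuous_iff_continuousAt.2 fun x => ?_
    have h2 : F.measure {x} = 0 := by
      rw [hF, ProbabilityTheory.measure_cdf]
      exact withDensity_absolutelyContinuous _ _ (by simp)
    rw [F.measure_singleton, ENNReal.ofReal_eq_zero, sub_nonpos] at h2
    rw [F.mono.continuousAt_iff_leftLim_eq_rightLim, F.rightLim_eq]
    exact le_antisymm (F.mono.leftLim_le le_rfl) h2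
  have hbot : Tendsto F atBot (𝓝 0) := ProbabilityTheory.tendsto_cdf_atBot P
  have htop : Tendsto F atTop (𝓝 1) := ProbabilityTheory.tendsto_cdf_atTop P
  set S : ℝ → Set ℝ := fun s => {x | s ≤ F x} with hS
  have hSne : ∀ s ∈ Ioo (0 : ℝ) 1, (S s).Nonempty := fun s hs =>
    ((htop.eventually (lt_mem_nhds hs.2)).exists).imp fun x hx => le_of_lt hx
  have hSbdd : ∀ s ∈ Ioo (0 : ℝ) 1, BddBelow (S s) := fun s hs => by
    obtain ⟨y, hy⟩ := (hbot.eventually (gt_mem_nhds hs.1)).exists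
    exact ⟨y, fun x hx => le_of_lt (hFmono.reflect_lt (lt_of_lt_of_le hy hx))⟩
  have hScl : ∀ s, IsClosed (S s) := fun s => isClosed_le continuous_const hFcont
  set Q : ℝ → ℝ := fun s => open Classical in if s ∈ Ioo (0 : ℝ) 1 then sInf (S s) else 0 with hQ
  have hQval : ∀ s ∈ Ioo (0 : ℝ) 1, Q s = sInf (S s) := fun s hs => if_pos hs
  have hQmem : ∀ s ∈ Ioo (0 : ℝ) 1, s ≤ F (Q s) := fun s hs => by
    rw [hQval s hs]; exact (hScl s).csInf_mem (hSne s hs) (hSbdd s hs)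
  have hQle : ∀ s ∈ Ioo (0 : ℝ) 1, ∀ x, Q s ≤ x ↔ s ≤ F x := fun s hs x =>
    ⟨fun h => (hQmem s hs).trans (hFmono h), fun h => by
      rw [hQval s hs]; exact csInf_le (hSbdd s hs) h⟩
  have hFQ : ∀ s ∈ Ioo (0 : ℝ) 1, F (Q s) = s := fun s hs => by
    refine le_antisymm ?_ (hQmem s hs)
    refine le_of_tendsto (hFcont.continuousAt.mono_left nhdsWithin_le_nhds : Tendsto F (𝓝[<] (Q s)) _) ?_
    filter_upwards [self_mem_nhdsWithin] with x hx
    exact le_of_lt (not_le.1 fun h => not_le.2 hx ((hQle s hs x).2 h))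
  have hQmono : MonotoneOn Q (Ioo 0 1) := fun s hs t ht hst =>
    (hQle s hs _).2 (hst.trans (hQmem t ht))
  have hQmeas : Measurable Q := by
    refine measurable_of_Iic fun x => ?_
    have : Q ⁻¹' Iic x = (Ioo 0 1 ∩ Iic (F x)) ∪ ((Ioo 0 1)ᶜ ∩ {_s | (0 : ℝ) ≤ x}) := by
      ext s
      by_cases hs : s ∈ Ioo (0 : ℝ) 1
      · simp only [mem_preimage, mem_Iic, hQle s hs, mem_union, mem_inter_iff, hs, mem_compl_iff]
        simp
      · simp only [mem_preimage, mem_Iic, mem_union, mem_inter_iff, hs, mem_compl_iff]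
        simp only [hQ, if_neg hs]
        simp
    rw [this]
    exact (measurableSet_Ioo.inter measurableSet_Iic).union
      (measurableSet_Ioo.compl.inter (MeasurableSet.const _))
  have : IsProbabilityMeasure (volume.restrict (Ioo (0 : ℝ) 1)) := ⟨by simp⟩
  have hmap : (volume.restrict (Ioo (0 : ℝ) 1)).map Q = P := by
    have := Measure.isProbabilityMeasure_map (μ := volume.restrict (Ioo (0 : ℝ) 1)) hQmeas.aemeasurable
    refine Measure.ext_of_Iic _ _ fun x => ?_
    rw [Measure.map_apply hQmeas measurableSet_Iic,
      Measure.restrict_apply (hQmeas measurableSet_Iic), ← ProbabilityTheory.ofReal_cdf P x]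
    have : Q ⁻¹' Iic x ∩ Ioo 0 1 = Ioo 0 1 ∩ Iic (F x) := by
      ext s
      by_cases hs : s ∈ Ioo (0 : ℝ) 1
      · simp only [mem_preimage, mem_Iic, hQle s hs, mem_inter_iff, hs]
        simp
      · simp [hs]
    have hx1 : F x ≤ 1 := ProbabilityTheory.cdf_le_one P x
    rw [this]
    refine le_antisymm ?_ ?_
    · refine (measure_mono (t := Ioc 0 (F x)) fun s hs => ⟨hs.1.1, hs.2⟩).trans ?_
      simp [hF]
    · refine le_trans ?_ (measure_mono (s := Ioo 0 (F x)) fun s hs =>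
        ⟨⟨hs.1, hs.2.trans_le hx1⟩, hs.2.le⟩)
      simp [hF]
  have hder : ∀ᵐ x ∂P, HasDerivAt F (f x).toReal x ∧ f x ≠ 0 ∧ f x ≠ ∞ := by
    have hac : P ≪ volume := withDensity_absolutelyContinuous _ _
    have e1 : ∀ᵐ x ∂P, HasDerivAt F (f x).toReal x := by
      refine hac.ae_le ?_
      have e2 : P.rnDeriv volume =ᵐ[volume] f := Measure.rnDeriv_withDensity volume hfm
      filter_upwards [F.ae_hasDerivAt, e2] with x hx hx2
      rw [hF, ProbabilityTheory.measure_cdf, hx2] at hx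
      exact hx
    have e3 : ∀ᵐ x ∂P, f x ≠ 0 := by
      rw [hP, ae_withDensity_iff hfm]; exact ae_of_all _ fun x h => h
    have e4 : ∀ᵐ x ∂P, f x ≠ ∞ := by
      refine hac.ae_le ?_
      refine (ae_lt_top hfm ?_).mono fun x hx => hx.ne
      rw [lintegral_const_mul _ hu, ← hI, ENNReal.inv_mul_cancel h0 h1]; simp
    filter_upwards [e1, e3, e4] with x a b c using ⟨a, b, c⟩
  refine ⟨Q, deriv Q, hQmeas, hQmono, ?_⟩
  have hder' : ∀ᵐ s ∂volume.restrict (Ioo (0 : ℝ) 1),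
      HasDerivAt F (f (Q s)).toReal (Q s) ∧ f (Q s) ≠ 0 ∧ f (Q s) ≠ ∞ := by
    rw [← hmap] at hder
    exact ae_of_ae_map hQmeas.aemeasurable hder
  filter_upwards [hder', hQmono.ae_differentiableWithinAt measurableSet_Ioo,
    ae_restrict_mem measurableSet_Ioo] with s ⟨hs1, hs2, hs3⟩ hs4 hs
  have hnhds : Ioo (0 : ℝ) 1 ∈ 𝓝 s := isOpen_Ioo.mem_nhds hs
  have hQd : HasDerivAt Q (deriv Q s) s := (hs4.differentiableAt hnhds).hasDerivAt
  have hcomp : HasDerivAt (fun s => F (Q s)) ((f (Q s)).toReal * deriv Q s) s := hs1.comp s hQd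
  have hid : HasDerivAt (fun s => F (Q s)) 1 s :=
    (hasDerivAt_id s).congr_of_eventuallyEq (by filter_upwards [hnhds] with t ht using hFQ t ht)
  have hprod := hcomp.unique hid
  have hpos : 0 < (f (Q s)).toReal := ENNReal.toReal_pos hs2 hs3
  refine ⟨hQd, ?_, ?_⟩
  · by_contra h
    nlinarith
  · have : f (Q s) * ENNReal.ofReal (deriv Q s) = 1 := by
      rw [← ENNReal.ofReal_toReal hs3, ← ENNReal.ofReal_mul hpos.le, hprod, ENNReal.ofReal_one]
    calc u (Q s) * ENNReal.ofReal (deriv Q s)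
        = I * (f (Q s) * ENNReal.ofReal (deriv Q s)) := by
          rw [hf, ← mul_assoc, ← mul_assoc, ENNReal.mul_inv_cancel h0 h1, one_mul]
      _ = I := by rw [this, mul_one]

/-- A Prékopa–Leindler inequality in which the pointwise lower bound is only assumed on average
over the interpolation parameter `t`. -/
def AveragedPrekopaLeindler (E : Type*) [AddCommGroup E] [Module ℝ E] [MeasureSpace E] : Prop :=
  ∀ (ν : Measure ℝ) [SFinite ν] (Θ : ℝ → E → ℝ≥0∞) (u v : E → ℝ≥0∞) (c : ℝ≥0∞),
    Measurable (Function.uncurry Θ) → Measurable u → Measurable v →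
    (∀ x y, u x ≠ 0 → u x ≠ ∞ → v y ≠ 0 → v y ≠ ∞ →
      c ≤ ∫⁻ t in Icc 0 1, Θ t ((1 - t) • x + t • y) / (u x ^ (1 - t) * v y ^ t) ∂ν) →
    ∫⁻ x, u x ≠ 0 → ∫⁻ x, u x ≠ ∞ → ∫⁻ x, v x ≠ 0 → ∫⁻ x, v x ≠ ∞ →
    c ≤ ∫⁻ t in Icc 0 1, (∫⁻ z, Θ t z) / ((∫⁻ x, u x) ^ (1 - t) * (∫⁻ x, v x) ^ t) ∂ν

/-- Dividing `I ^ (1 - t) * J ^ t` by `u ^ (1 - t) * v ^ t` leaves `a ^ (1 - t) * b ^ t`, and AM-GM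
bounds this by the Jacobian of the interpolated transport. -/
theorem geom_mean_factor_le {u v I J : ℝ≥0∞} {a b t : ℝ} (ha : 0 < a) (hb : 0 < b)
    (hu : u * ENNReal.ofReal a = I)
    (hv : v * ENNReal.ofReal b = J) (ht : t ∈ Icc (0 : ℝ) 1) :
    (u ^ (1 - t) * v ^ t)⁻¹ ≤
      ENNReal.ofReal ((1 - t) * a + t * b) * (I ^ (1 - t) * J ^ t)⁻¹ := by
  have t0 : 0 ≤ t := ht.1
  have t1 : 0 ≤ 1 - t := sub_nonneg.2 ht.2
  have hA : ENNReal.ofReal a ≠ 0 := by simpa using ha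
  have hB : ENNReal.ofReal b ≠ 0 := by simpa using hb
  have hA' : ENNReal.ofReal a ≠ ∞ := ENNReal.ofReal_ne_top
  have hB' : ENNReal.ofReal b ≠ ∞ := ENNReal.ofReal_ne_top
  have key : ENNReal.ofReal a ^ (1 - t) * ENNReal.ofReal b ^ t ≤
      ENNReal.ofReal ((1 - t) * a + t * b) := by
    rw [ENNReal.ofReal_rpow_of_pos ha, ENNReal.ofReal_rpow_of_pos hb,
      ← ENNReal.ofReal_mul (by positivity)]
    exact ENNReal.ofReal_le_ofReal
      (Real.geom_mean_le_arith_mean2_weighted t1 t0 ha.le hb.le (by ring))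
  have hne : ∀ {x : ℝ≥0∞} {r : ℝ}, x ≠ 0 → x ≠ ∞ → 0 ≤ r → x ^ r ≠ 0 ∧ x ^ r ≠ ∞ :=
    fun hx hx' hr => ⟨(ENNReal.rpow_pos (pos_iff_ne_zero.2 hx) hx').ne',
      ENNReal.rpow_ne_top_of_nonneg hr hx'⟩
  have e : I ^ (1 - t) * J ^ t = (u ^ (1 - t) * v ^ t) *
      (ENNReal.ofReal a ^ (1 - t) * ENNReal.ofReal b ^ t) := by
    rw [← hu, ← hv, ENNReal.mul_rpow_of_nonneg _ _ t1, ENNReal.mul_rpow_of_nonneg _ _ t0]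
    ring
  have n1 := hne hA hA' t1
  have n2 := hne hB hB' t0
  have m1 := mul_ne_zero n1.1 n2.1
  have m2 := ENNReal.mul_ne_top n1.2 n2.2
  refine le_trans ?_ (mul_le_mul_left key _)
  rw [e, ENNReal.mul_inv (Or.inr m2) (Or.inr m1), mul_comm (u ^ (1 - t) * v ^ t)⁻¹, ← mul_assoc,
    ENNReal.mul_inv_cancel m1 m2, one_mul]

/-- The hypothesis is used only at the coupled points `Q s`, `R s`, integrated over `s`, and the
integrals are exchanged. For fixed `t` the map `s ↦ (1 - t) * Q s + t * R s` is monotone, so a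
change of variables recovers at most `∫ Θ t`. -/
theorem averagedPrekopaLeindler_real : AveragedPrekopaLeindler ℝ := by
  intro ν _ Θ u v c hΘ hu hv H h0 h1 k0 k1
  obtain ⟨Q, q, hQ, hQm, hQd⟩ := exists_quantile_density hu h0 h1
  obtain ⟨R, r, hR, hRm, hRd⟩ := exists_quantile_density hv k0 k1
  set I := ∫⁻ x, u x
  set J := ∫⁻ x, v x
  -- The change of variables needs the derivatives at every point of a measurable set, so the null
  -- exceptional set is removed.
  obtain ⟨S, hSae, hSm, hS⟩ := (hQd.and hRd).exists_measurable_mem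
  set W := S ∩ Ioo (0 : ℝ) 1
  have hWm : MeasurableSet W := hSm.inter measurableSet_Ioo
  have hW1 : volume W = 1 := by
    have := measure_inter_add_sdiff (μ := volume) (Ioo (0 : ℝ) 1) hSm
    have h2 : volume (Ioo (0 : ℝ) 1 \ S) = 0 := by
      rw [mem_ae_iff, Measure.restrict_apply hSm.compl] at hSae
      rwa [sdiff_eq, inter_comm]
    rw [h2, add_zero, inter_comm] at this
    rw [this]; simp
  have hz : Measurable fun p : ℝ × ℝ => (1 - p.1) * Q p.2 + p.1 * R p.2 := by fun_prop
  have hmeas : Measurable fun p : ℝ × ℝ =>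
      Θ p.1 ((1 - p.1) * Q p.2 + p.1 * R p.2) / (u (Q p.2) ^ (1 - p.1) * v (R p.2) ^ p.1) := by
    have := hΘ.comp (measurable_fst.prodMk hz)
    refine Measurable.div this ?_
    fun_prop
  calc c = ∫⁻ s in W, c := by simp [hW1]
    _ ≤ ∫⁻ s in W, ∫⁻ t in Icc 0 1,
          Θ t ((1 - t) * Q s + t * R s) / (u (Q s) ^ (1 - t) * v (R s) ^ t) ∂ν := by
        refine setLIntegral_mono' hWm fun s hs => ?_
        obtain ⟨⟨-, a1, a2⟩, -, b1, b2⟩ := hS s hs.1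
        refine H (Q s) (R s) ?_ ?_ ?_ ?_
        · intro h; rw [h, zero_mul] at a2; exact h0 a2.symm
        · intro h; rw [h, ENNReal.top_mul (by simpa using a1)] at a2; exact h1 a2.symm
        · intro h; rw [h, zero_mul] at b2; exact k0 b2.symm
        · intro h; rw [h, ENNReal.top_mul (by simpa using b1)] at b2; exact k1 b2.symm
    _ = ∫⁻ t in Icc 0 1, (∫⁻ s in W,
          Θ t ((1 - t) * Q s + t * R s) / (u (Q s) ^ (1 - t) * v (R s) ^ t)) ∂ν :=
        lintegral_lintegral_swap (by exact (hmeas.comp measurable_swap).aemeasurable)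
    _ ≤ _ := by
        refine setLIntegral_mono' measurableSet_Icc fun t ht => ?_
        have t0 : 0 ≤ t := ht.1
        have t1 : 0 ≤ 1 - t := sub_nonneg.2 ht.2
        have hΘt : Measurable (Θ t) := hΘ.of_uncurry_left
        calc ∫⁻ s in W, Θ t ((1 - t) * Q s + t * R s) / (u (Q s) ^ (1 - t) * v (R s) ^ t)
            ≤ ∫⁻ s in W, (ENNReal.ofReal ((1 - t) * q s + t * r s) *
                Θ t ((1 - t) * Q s + t * R s)) * (I ^ (1 - t) * J ^ t)⁻¹ := by
              refine setLIntegral_mono' hWm fun s hs => ?_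
              obtain ⟨⟨-, a1, a2⟩, -, b1, b2⟩ := hS s hs.1
              rw [div_eq_mul_inv, mul_comm (ENNReal.ofReal _), mul_assoc]
              exact mul_le_mul_right (geom_mean_factor_le a1 b1 a2 b2 ht) _
          _ = (∫⁻ s in W, ENNReal.ofReal ((1 - t) * q s + t * r s) *
                Θ t ((1 - t) * Q s + t * R s)) * (I ^ (1 - t) * J ^ t)⁻¹ := by
              refine lintegral_mul_const' _ _ (ENNReal.inv_ne_top.2 (mul_ne_zero ?_ ?_))
              · exact (ENNReal.rpow_pos (pos_iff_ne_zero.2 h0) h1).ne'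
              · exact (ENNReal.rpow_pos (pos_iff_ne_zero.2 k0) k1).ne'
          _ ≤ _ := by
              rw [div_eq_mul_inv]
              refine mul_le_mul_left ?_ _
              rw [← lintegral_image_eq_lintegral_deriv_mul_of_monotoneOn
                (f := fun s => (1 - t) * Q s + t * R s) (f' := fun s => (1 - t) * q s + t * r s) hWm]
              · exact setLIntegral_le_lintegral _ _
              · intro s hs
                obtain ⟨⟨a, -⟩, b, -⟩ := hS s hs.1
                exact ((a.const_mul _).add (b.const_mul _)).hasDerivWithinAt
              · intro s hs s' hs' h
                have := hQm hs.2 hs'.2 h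
                have := hRm hs.2 hs'.2 h
                dsimp only
                gcongr

/-- The conclusion on the fibres over `x` and `y` is exactly the hypothesis for the marginals. On
the fibres the function is `Θ t ((1 - t) • x + t • y, ·)`, which is why `Θ` must be allowed to
depend on `t`. -/
theorem AveragedPrekopaLeindler.prod {E F : Type*} [AddCommGroup E] [Module ℝ E] [MeasureSpace E]
    [AddCommGroup F] [Module ℝ F] [MeasureSpace F] [MeasurableAdd₂ E] [MeasurableSMul ℝ E]
    [SFinite (volume : Measure F)] [SFinite (volume : Measure E)]
    (hE : AveragedPrekopaLeindler E) (hF : AveragedPrekopaLeindler F) :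
    AveragedPrekopaLeindler (E × F) := by
  intro ν _ Θ u v c hΘ hu hv H h0 h1 k0 k1
  rw [Measure.volume_eq_prod, lintegral_prod _ hu.aemeasurable] at h0 h1
  rw [Measure.volume_eq_prod, lintegral_prod _ hv.aemeasurable] at k0 k1
  have hΘ' : Measurable fun p : (ℝ × E) × F => Θ p.1.1 (p.1.2, p.2) :=
    hΘ.comp (measurable_fst.fst.prodMk (measurable_fst.snd.prodMk measurable_snd))
  have key := hE ν (fun t x => ∫⁻ y, Θ t (x, y)) (fun x => ∫⁻ y, u (x, y)) (fun x => ∫⁻ y, v (x, y)) c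
    (hΘ'.lintegral_prod_right' (ν := volume)) hu.lintegral_prod_right' hv.lintegral_prod_right'
    (fun x y hx hx' hy hy' => by
      refine hF ν (fun t z => Θ t ((1 - t) • x + t • y, z)) (fun z => u (x, z)) (fun z => v (y, z)) c
        ?_ (hu.comp measurable_prodMk_left) (hv.comp measurable_prodMk_left) ?_ hx hx' hy hy'
      · refine hΘ.comp (measurable_fst.prodMk (Measurable.prodMk ?_ measurable_snd))
        have h1 : Measurable fun t : ℝ => (1 - t) • x :=
          (measurable_smul_const x).comp (measurable_const.sub measurable_id)
        have h2 : Measurable fun t : ℝ => t • y := measurable_smul_const y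
        exact (h1.add h2).comp measurable_fst
      · intro z w hz hz' hw hw'
        exact H (x, z) (y, w) hz hz' hw hw')
    h0 h1 k0 k1
  simp only [Measure.volume_eq_prod, lintegral_prod _ hu.aemeasurable,
    lintegral_prod _ hv.aemeasurable]
  refine key.trans_eq (setLIntegral_congr_fun measurableSet_Icc fun t _ => ?_)
  rw [lintegral_prod _ (hΘ.of_uncurry_left (x := t)).aemeasurable]

theorem AveragedPrekopaLeindler.of_equiv {E F : Type*} [AddCommGroup E] [Module ℝ E]
    [MeasureSpace E] [AddCommGroup F] [Module ℝ F] [MeasureSpace F] (e : E ≃ᵐ F)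
    (he : MeasurePreserving e) (hl : ∀ (s t : ℝ) (x y : E), e (s • x + t • y) = s • e x + t • e y)
    (hE : AveragedPrekopaLeindler E) : AveragedPrekopaLeindler F := by
  intro ν _ Θ u v c hΘ hu hv H h0 h1 k0 k1
  have hi : ∀ g : F → ℝ≥0∞, ∫⁻ x, g (e x) = ∫⁻ y, g y := fun g =>
    he.lintegral_comp_emb e.measurableEmbedding g
  have key := hE ν (fun t x => Θ t (e x)) (fun x => u (e x)) (fun x => v (e x)) c
    (hΘ.comp (measurable_fst.prodMk (e.measurable.comp measurable_snd))) (hu.comp e.measurable)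
    (hv.comp e.measurable) (fun x y => by simpa only [hl] using H (e x) (e y))
  simp only [hi] at key
  exact key h0 h1 k0 k1

theorem averagedPrekopaLeindler_pi (k : ℕ) : AveragedPrekopaLeindler (Fin k → ℝ) := by
  induction k with
  | zero =>
    intro ν _ Θ u v c hΘ hu hv H h0 h1 k0 k1
    have hi : ∀ g : (Fin 0 → ℝ) → ℝ≥0∞, ∫⁻ x, g x = g 0 := fun g => by
      rw [volume_pi, Measure.pi_of_empty _ 0, lintegral_dirac]
    simp only [hi] at *
    simpa using H 0 0 h0 h1 k0 k1
  | succ k ih =>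
    refine (averagedPrekopaLeindler_real.prod ih).of_equiv
      (MeasurableEquiv.piFinSuccAbove (fun _ : Fin (k + 1) => ℝ) 0).symm
      (volume_preserving_piFinSuccAbove (fun _ : Fin (k + 1) => ℝ) 0).symm ?_
    intro s t x y
    ext i
    refine Fin.cases ?_ (fun j => ?_) i <;> simp [MeasurableEquiv.piFinSuccAbove]

theorem averagedPrekopaLeindler_euclideanSpace (k : ℕ) :
    AveragedPrekopaLeindler (EuclideanSpace ℝ (Fin k)) :=
  (averagedPrekopaLeindler_pi k).of_equiv (MeasurableEquiv.toLp 2 (Fin k → ℝ))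
    (PiLp.volume_preserving_toLp (Fin k)) fun _ _ _ _ => rfl

/-! ### Log-concave measures and linear Remez functions -/

/-- A finite measurable log-concave probability density. -/
structure IsLogConcaveProbDensity {k : ℕ} (q : EuclideanSpace ℝ (Fin k) → ℝ≥0∞) : Prop where
  measurable : Measurable q
  ne_top : ∀ x, q x ≠ ∞
  lintegral_eq_one : ∫⁻ x, q x = 1
  interpolate : ∀ x y, ∀ t ∈ Icc (0 : ℝ) 1,
    q x ^ (1 - t) * q y ^ t ≤ q ((1 - t) • x + t • y)

/-- A function satisfying the Remez inequality with exponent one on segments joining points of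
`{q ≠ 0}`. -/
def IsLinearRemez {k : ℕ} (q g : EuclideanSpace ℝ (Fin k) → ℝ≥0∞) : Prop :=
  ∀ x y, q x ≠ 0 → q y ≠ 0 → ∀ b : ℝ≥0∞,
    g x * volume {t ∈ Icc (0 : ℝ) 1 | g ((1 - t) • x + t • y) ≤ b} ≤ 4 * b

variable {k : ℕ} {q g : EuclideanSpace ℝ (Fin k) → ℝ≥0∞}

theorem IsLogConcaveProbDensity.isProbabilityMeasure (hq : IsLogConcaveProbDensity q) :
    IsProbabilityMeasure (volume.withDensity q) :=
  ⟨by rw [withDensity_apply _ MeasurableSet.univ, Measure.restrict_univ, hq.lintegral_eq_one]⟩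

/-- Averaged Prékopa–Leindler for `U.indicator q`, `q` and `Aᶜ.indicator q`, with Lebesgue measure
on `[1 - η, 1]`. Off `A` log-concavity makes the integrand at least `1`, and this happens on length
at least `η - δ`. On that interval `P U ^ (1 - t) ≥ P U ^ η`. -/
theorem IsLogConcaveProbDensity.measure_rpow_le (hq : IsLogConcaveProbDensity q)
    {U A : Set (EuclideanSpace ℝ (Fin k))} (hU : MeasurableSet U) (hA : MeasurableSet A)
    {δ η : ℝ} (hη0 : 0 < η) (hη1 : η ≤ 1) (hδ : 0 ≤ δ)
    (H : ∀ x ∈ U, q x ≠ 0 → ∀ y, q y ≠ 0 →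
      volume {t ∈ Icc (0 : ℝ) 1 | (1 - t) • x + t • y ∈ A} ≤ ENNReal.ofReal δ) :
    ENNReal.ofReal (η - δ) * volume.withDensity q U ^ η ≤
      ENNReal.ofReal η * volume.withDensity q Aᶜ := by
  have := hq.isProbabilityMeasure
  set P := volume.withDensity q with hP
  rcases eq_or_ne (P U) 0 with hPU | hPU
  · simp [hPU, hη0]
  have hPU1 : P U ≤ 1 := prob_le_one
  have iU : ∫⁻ x, U.indicator q x = P U := by
    rw [lintegral_indicator hU, hP, withDensity_apply _ hU]
  have iA : ∫⁻ x, Aᶜ.indicator q x = P Aᶜ := by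
    rw [lintegral_indicator hA.compl, hP, withDensity_apply _ hA.compl]
  have key := averagedPrekopaLeindler_euclideanSpace k (volume.restrict (Icc (1 - η) 1))
    (fun _ => Aᶜ.indicator q) (U.indicator q) q (ENNReal.ofReal (η - δ))
    ((hq.measurable.indicator hA.compl).comp measurable_snd) (hq.measurable.indicator hU)
    hq.measurable ?_ (by rwa [iU]) (by rw [iU]; exact ne_top_of_le_ne_top ENNReal.one_ne_top hPU1)
    (by simp [hq.lintegral_eq_one]) (by simp [hq.lintegral_eq_one])
  · simp only [iU, iA, hq.lintegral_eq_one, ENNReal.one_rpow, mul_one] at key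
    rw [Measure.restrict_restrict measurableSet_Icc,
      inter_eq_self_of_subset_right (Icc_subset_Icc_left (by linarith))] at key
    have h2 : ENNReal.ofReal (η - δ) ≤ ∫⁻ _t in Icc (1 - η) 1, P Aᶜ / P U ^ η := by
      refine key.trans (setLIntegral_mono' measurableSet_Icc fun t ht => ?_)
      exact ENNReal.div_le_div_left
        (ENNReal.rpow_le_rpow_of_exponent_ge hPU1 (by linarith [ht.1])) _
    rw [setLIntegral_const, Real.volume_Icc, sub_sub_cancel, mul_comm, ← mul_div_assoc] at h2
    exact (ENNReal.le_div_iff_mul_le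
      (Or.inl (ENNReal.rpow_pos (pos_iff_ne_zero.2 hPU) (measure_ne_top _ _)).ne')
      (Or.inr (ENNReal.mul_ne_top (by simp) (measure_ne_top _ _)))).1 h2
  · intro x y hx _ hy hy'
    have hxU : x ∈ U := by by_contra h; simp [h] at hx
    rw [indicator_of_mem hxU] at hx ⊢
    have hqx := hq.ne_top x
    rw [Measure.restrict_restrict measurableSet_Icc,
      inter_eq_self_of_subset_right (Icc_subset_Icc_left (by linarith))]
    set B : Set ℝ := {t ∈ Icc (0 : ℝ) 1 | (1 - t) • x + t • y ∈ A}
    have hB : MeasurableSet B := measurableSet_Icc.inter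
      (hA.preimage (f := fun t : ℝ => (1 - t) • x + t • y) (by fun_prop))
    calc ENNReal.ofReal (η - δ) = ENNReal.ofReal η - ENNReal.ofReal δ := ENNReal.ofReal_sub _ hδ
      _ ≤ volume (Icc (1 - η) 1) - volume B :=
          tsub_le_tsub (by simp) (H x hxU hx y hy)
      _ ≤ volume (Icc (1 - η) 1 \ B) := le_measure_sdiff
      _ = ∫⁻ t in Icc (1 - η) 1 \ B, 1 := by simp
      _ ≤ ∫⁻ t in Icc (1 - η) 1 \ B,
            Aᶜ.indicator q ((1 - t) • x + t • y) / (q x ^ (1 - t) * q y ^ t) := by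
          refine setLIntegral_mono' (measurableSet_Icc.diff hB) fun t ht => ?_
          have ht1 : t ∈ Icc (0 : ℝ) 1 := ⟨by linarith [ht.1.1], ht.1.2⟩
          have htA : (1 - t) • x + t • y ∈ Aᶜ := fun h => ht.2 ⟨ht1, h⟩
          rw [indicator_of_mem htA, ENNReal.le_div_iff_mul_le, one_mul]
          · exact hq.interpolate x y t ht1
          · exact Or.inl (mul_ne_zero (ENNReal.rpow_pos (pos_iff_ne_zero.2 hx) hqx).ne'
              (ENNReal.rpow_pos (pos_iff_ne_zero.2 hy) hy').ne')
          · exact Or.inl (ENNReal.mul_ne_top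
              (ENNReal.rpow_ne_top_of_nonneg (by linarith [ht1.2]) hqx)
              (ENNReal.rpow_ne_top_of_nonneg ht1.1 hy'))
      _ ≤ _ := lintegral_mono_set sdiff_subset

/-! ### Tails of `g` above and below its upper quartile -/

theorem exists_upper_quartile {α : Type*} [MeasurableSpace α] (P : Measure α)
    [IsProbabilityMeasure P] {g : α → ℝ≥0∞} (hg : Measurable g) (hgt : ∀ x, g x ≠ ∞) :
    ∃ a : ℝ≥0∞, a ≠ ∞ ∧ P {x | a < g x} ≤ 1 / 4 ∧ 1 / 4 ≤ P {x | a ≤ g x} := by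
  set S : Set ℝ≥0∞ := {b | P {x | b < g x} ≤ 1 / 4}
  have hS : S.Nonempty := ⟨∞, by simp [S]⟩
  have hlt : ∀ b, b < sInf S → P {x | g x ≤ b} ≤ 3 / 4 := fun b hb => by
    have h1 : ¬ P {x | b < g x} ≤ 1 / 4 := fun h => not_le.2 hb (sInf_le h)
    have h2 : {x | g x ≤ b} = {x | b < g x}ᶜ := by ext; simp
    rw [h2, prob_compl_eq_one_sub (measurableSet_lt measurable_const hg), tsub_le_iff_right]
    calc (1 : ℝ≥0∞) = 3 / 4 + 1 / 4 := by
          rw [ENNReal.div_add_div_same]; norm_num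
          rw [ENNReal.div_self] <;> norm_num
      _ ≤ _ := by gcongr; exact (not_le.1 h1).le
  have hle : P {x | g x < sInf S} ≤ 3 / 4 := by
    rcases eq_or_ne (sInf S) 0 with h0 | h0
    · simp [h0]
    obtain ⟨u, hu, hu2, hu3⟩ := exists_seq_strictMono_tendsto' (pos_iff_ne_zero.2 h0)
    have : {x | g x < sInf S} = ⋃ n, {x | g x ≤ u n} := by
      ext x
      simp only [mem_ofPred_eq, mem_iUnion]
      exact ⟨fun h => ((hu3.eventually (lt_mem_nhds h)).exists).imp fun _ h => h.le,
        fun ⟨n, h⟩ => h.trans_lt (hu2 n).2⟩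
    have hmono : Monotone fun n => {x | g x ≤ u n} :=
      fun m n hmn x hx => le_trans hx (hu.monotone hmn)
    rw [this, hmono.measure_iUnion]
    exact iSup_le fun n => hlt _ (hu2 n).2
  refine ⟨sInf S, fun htop => ?_, ?_, ?_⟩
  · rw [htop] at hle
    simp only [lt_top_iff_ne_top, hgt, not_false_eq_true, ne_eq, ofPred_true, measure_univ] at hle
    rw [ENNReal.le_div_iff_mul_le (by norm_num) (by norm_num)] at hle
    norm_num at hle
  · obtain ⟨u, hu, hu3, huS⟩ := exists_seq_tendsto_sInf hS (OrderBot.bddBelow S)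
    have : {x | sInf S < g x} = ⋃ n, {x | u n < g x} := by
      ext x
      simp only [mem_ofPred_eq, mem_iUnion]
      exact ⟨fun h => (hu3.eventually (gt_mem_nhds h)).exists,
        fun ⟨n, h⟩ => (sInf_le (huS n)).trans_lt h⟩
    have hmono : Monotone fun n => {x | u n < g x} :=
      fun m n hmn x hx => lt_of_le_of_lt (hu hmn) hx
    rw [this, hmono.measure_iUnion]
    exact iSup_le fun n => huS n
  · have h2 : {x | sInf S ≤ g x} = {x | g x < sInf S}ᶜ := by ext; simp
    rw [h2, prob_compl_eq_one_sub (measurableSet_lt hg measurable_const)]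
    refine ENNReal.le_sub_of_add_le_left (measure_ne_top _ _) ?_
    calc _ ≤ (3 / 4 : ℝ≥0∞) + 1 / 4 := by gcongr
      _ = 1 := by
          rw [ENNReal.div_add_div_same]; norm_num
          rw [ENNReal.div_self] <;> norm_num

/-- The Remez inequality gives `δ = 4 / j`; the choice `η = 2 δ` turns `measure_rpow_le` into `P U ^
(8 / j) ≤ 1 / 2 ≤ exp (-1 / 2)`. The condition `η ≤ 1` fails for `j < 8`, where the bound is trivial
thanks to the factor `2`. -/
theorem IsLogConcaveProbDensity.measure_gt_le (hq : IsLogConcaveProbDensity q) (hg : Measurable g)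
    (hR : IsLinearRemez q g) {a : ℝ≥0∞} (ha : a ≠ ∞)
    (ha4 : volume.withDensity q {x | a < g x} ≤ 1 / 4) (j : ℕ) :
    volume.withDensity q {x | j * a < g x} ≤ 2 * ENNReal.ofReal (Real.exp (-(j / 16))) := by
  have := hq.isProbabilityMeasure
  set P := volume.withDensity q
  rcases le_or_gt j 8 with hj | hj
  · have h1 : (1 : ℝ) ≤ 2 * Real.exp (-(j / 16)) := by
      have : (j : ℝ) ≤ 8 := by exact_mod_cast hj
      linarith [Real.add_one_le_exp (-(j / 16 : ℝ))]
    calc _ ≤ (1 : ℝ≥0∞) := prob_le_one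
      _ ≤ ENNReal.ofReal (2 * Real.exp (-(j / 16))) := by
          rw [← ENNReal.ofReal_one]; exact ENNReal.ofReal_le_ofReal h1
      _ = _ := by rw [ENNReal.ofReal_mul (by norm_num)]; simp
  have hj0 : (8 : ℝ) < j := by exact_mod_cast hj
  have hj1 : (0 : ℝ) < j := by linarith
  have key := hq.measure_rpow_le (U := {x | j * a < g x}) (A := {x | g x ≤ a})
    (measurableSet_lt measurable_const hg) (measurableSet_le hg measurable_const)
    (δ := 4 / j) (η := 8 / j) (by positivity) ((div_le_one hj1).2 hj0.le) (by positivity) ?_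
  · have hc : {x | g x ≤ a}ᶜ = {x | a < g x} := by ext; simp
    rw [hc, show (8 / j - 4 / j : ℝ) = 4 / j by ring] at key
    set u := P {x | j * a < g x} with hu
    have hu' : u ≠ ∞ := measure_ne_top _ _
    have h2 : (4 / j : ℝ) * u.toReal ^ (8 / j : ℝ) ≤ 8 / j * (1 / 4) := by
      have h3 := key.trans (mul_le_mul_right ha4 _)
      have h4 := ENNReal.toReal_mono (ENNReal.mul_ne_top (by simp) (by simp)) h3
      rw [ENNReal.toReal_mul, ENNReal.toReal_mul, ENNReal.toReal_ofReal (by positivity),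
        ENNReal.toReal_ofReal (by positivity), ← ENNReal.toReal_rpow] at h4
      simpa using h4
    have h3 : u.toReal ^ (8 / j : ℝ) ≤ 1 / 2 := by
      have h6 : (0 : ℝ) < 4 / j := by positivity
      refine le_of_mul_le_mul_left (h2.trans_eq ?_) h6
      ring
    have h4 : (1 / 2 : ℝ) ≤ Real.exp (-(1 / 2)) := by
      linarith [Real.add_one_le_exp (-(1 / 2 : ℝ))]
    have h5 : u.toReal ≤ Real.exp (-(j / 16)) := by
      have h7 := Real.rpow_le_rpow (z := j / 8) (by positivity) (h3.trans h4) (by positivity)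
      rw [← Real.rpow_mul ENNReal.toReal_nonneg, ← Real.exp_mul] at h7
      have e1 : (8 / j * (j / 8) : ℝ) = 1 := by field_simp
      rw [e1, Real.rpow_one] at h7
      exact h7.trans_eq (by ring_nf)
    calc u = ENNReal.ofReal u.toReal := (ENNReal.ofReal_toReal hu').symm
      _ ≤ ENNReal.ofReal (Real.exp (-(j / 16))) := ENNReal.ofReal_le_ofReal h5
      _ ≤ _ := le_mul_of_one_le_left zero_le (by norm_num)
  · intro x hx hqx y hqy
    have h1 := hR x y hqx hqy a
    simp only [mem_ofPred_eq] at hx ⊢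
    set w := volume {t ∈ Icc (0 : ℝ) 1 | g ((1 - t) • x + t • y) ≤ a}
    rcases eq_or_ne a 0 with rfl | ha0
    · simp only [mul_zero, nonpos_iff_eq_zero, mul_eq_zero] at h1 hx
      rcases h1 with h1 | h1
      · simp [h1] at hx
      · simp [h1]
    · have h2 : (j * w) * a ≤ 4 * a := by
        refine le_trans ?_ h1
        rw [mul_right_comm]
        exact mul_le_mul_left hx.le _
      have h3 : j * w ≤ 4 := (ENNReal.mul_le_mul_iff_left ha0 ha).1 h2
      rw [ENNReal.ofReal_div_of_pos hj1, ENNReal.ofReal_natCast,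
        ENNReal.le_div_iff_mul_le (by simp) (by simp), mul_comm]
      simpa using h3

theorem one_sub_two_mul_le_rpow {u η : ℝ} (hu : 1 / 4 ≤ u) (hη : 0 ≤ η) : 1 - 2 * η ≤ u ^ η := by
  have h1 : (1 / 4 : ℝ) ^ η ≤ u ^ η := Real.rpow_le_rpow (by norm_num) hu hη
  refine le_trans ?_ h1
  rw [Real.rpow_def_of_pos (by norm_num)]
  have h2 : Real.log (1 / 4) = -(2 * Real.log 2) := by
    rw [show (1 / 4 : ℝ) = (2 ^ 2)⁻¹ by norm_num, Real.log_inv, Real.log_pow]; norm_num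
  have := Real.add_one_le_exp (Real.log (1 / 4) * η)
  have := Real.log_two_lt_d9
  nlinarith

/-- With `ε = 2⁻ʲ` the Remez inequality gives `δ = 4 ε²`. Taking `η = 2 ε` makes both losses linear
in `ε`: `1 - δ / η = 1 - 2 ε` and `P U ^ η ≥ 1 - 4 ε`, whence the constant `6`. -/
theorem IsLogConcaveProbDensity.measure_le_le (hq : IsLogConcaveProbDensity q) (hg : Measurable g)
    (hR : IsLinearRemez q g) {a : ℝ≥0∞} (ha : a ≠ ∞) (ha0 : a ≠ 0)
    (ha4 : 1 / 4 ≤ volume.withDensity q {x | a ≤ g x}) (j : ℕ) :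
    volume.withDensity q {x | g x ≤ 4⁻¹ ^ j * a} ≤ 6 * 2⁻¹ ^ j := by
  have := hq.isProbabilityMeasure
  set P := volume.withDensity q
  set A := {x | g x ≤ 4⁻¹ ^ j * a}
  have hA : MeasurableSet A := measurableSet_le hg measurable_const
  set ε : ℝ := (1 / 2) ^ j with hε
  have hε0 : 0 < ε := by positivity
  have hε2 : ENNReal.ofReal ε = 2⁻¹ ^ j := by
    rw [hε, ENNReal.ofReal_pow (by norm_num), one_div, ENNReal.ofReal_inv_of_pos (by norm_num)]
    simp
  suffices h : (P A).toReal ≤ 6 * ε by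
    rw [← hε2, ← ENNReal.ofReal_toReal (measure_ne_top P A),
      show (6 : ℝ≥0∞) = ENNReal.ofReal 6 by simp, ← ENNReal.ofReal_mul (by norm_num)]
    exact ENNReal.ofReal_le_ofReal h
  have hA1 : (P A).toReal ≤ 1 := by
    simpa using ENNReal.toReal_mono ENNReal.one_ne_top (prob_le_one (μ := P) (s := A))
  rcases le_or_gt (1 / 4) ε with h4 | h4
  · linarith
  have key := hq.measure_rpow_le (U := {x | a ≤ g x}) (A := A)
    (measurableSet_le measurable_const hg) hA
    (δ := 4 * ε ^ 2) (η := 2 * ε) (by positivity) (by linarith) (by positivity) ?_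
  · have hAc : (P Aᶜ).toReal = 1 - (P A).toReal := by
      rw [prob_compl_eq_one_sub hA, ENNReal.toReal_sub_of_le prob_le_one ENNReal.one_ne_top]; simp
    have h5 := ENNReal.toReal_mono (ENNReal.mul_ne_top ENNReal.ofReal_ne_top (measure_ne_top _ _)) key
    have hd : 0 ≤ 2 * ε - 4 * ε ^ 2 := by nlinarith
    rw [ENNReal.toReal_mul, ENNReal.toReal_mul, ENNReal.toReal_ofReal hd,
      ENNReal.toReal_ofReal (by positivity), ← ENNReal.toReal_rpow, hAc] at h5
    have h6 : (1 / 4 : ℝ) ≤ (P {x | a ≤ g x}).toReal := by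
      simpa using ENNReal.toReal_mono (measure_ne_top _ _) ha4
    have h7 := one_sub_two_mul_le_rpow h6 (η := 2 * ε) (by positivity)
    have h8 := (mul_le_mul_of_nonneg_left h7 hd).trans h5
    have h9 : (1 - 2 * ε) * (1 - 2 * (2 * ε)) ≤ 1 - (P A).toReal := by
      refine le_of_mul_le_mul_left (le_trans (le_of_eq ?_) h8) (show 0 < 2 * ε by positivity)
      ring
    nlinarith
  · intro x hx hqx y hqy
    have h1 := hR x y hqx hqy (4⁻¹ ^ j * a)
    simp only [mem_ofPred_eq] at hx ⊢
    simp only [A, mem_ofPred_eq]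
    set w := volume {t ∈ Icc (0 : ℝ) 1 | g ((1 - t) • x + t • y) ≤ 4⁻¹ ^ j * a}
    have h2 : w * a ≤ (4 * 4⁻¹ ^ j) * a := by
      rw [mul_assoc, mul_comm]
      exact (mul_le_mul_left hx _).trans h1
    refine ((ENNReal.mul_le_mul_iff_left ha0 ha).1 h2).trans_eq ?_
    rw [hε, ← pow_mul, mul_comm j 2, pow_mul, ENNReal.ofReal_mul (by norm_num),
      ENNReal.ofReal_pow (by norm_num), show ((1 / 2 : ℝ) ^ 2) = 4⁻¹ by norm_num,
      ENNReal.ofReal_inv_of_pos (by norm_num)]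
    simp

/-! ### Moments from the upper tail -/

/-- The bound `z ≤ exp z` at `z = y / (32 s)`, raised to the power `s`. The rate `1 / 32` is half
that of the tail in `measure_gt_le`, so the series in `exists_moment_bound` converges. -/
theorem rpow_le_mul_exp {y s : ℝ} (hy : 0 ≤ y) (hs : 0 < s) :
    y ^ s ≤ (32 * s) ^ s * Real.exp (y / 32) := by
  have h1 : y / (32 * s) ≤ Real.exp (y / (32 * s)) := by
    linarith [Real.add_one_le_exp (y / (32 * s))]
  have h2 := Real.rpow_le_rpow (by positivity) h1 hs.le
  rw [← Real.exp_mul, Real.div_rpow hy (by positivity), div_le_iff₀ (by positivity)] at h2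
  rw [mul_comm]
  refine h2.trans_eq ?_
  congr 2
  field_simp

/-- A step function dominating `exp (y / 32)` for `y = g / a`. -/
def expStepSum (a y : ℝ≥0∞) : ℝ≥0∞ :=
  1 + ∑' j : ℕ, ENNReal.ofReal (Real.exp ((j + 1) / 32)) *
    ({z | j * a < z} : Set ℝ≥0∞).indicator 1 y

theorem rpow_le_expStepSum {a y : ℝ≥0∞} (ha : a ≠ ∞) (ha0 : a ≠ 0) (hy : y ≠ ∞) {s : ℝ}
    (hs : 0 < s) : y ^ s ≤ (ENNReal.ofReal (32 * s) * a) ^ s * expStepSum a y := by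
  set w : ℝ := (y / a).toReal with hw
  have hya : y / a ≠ ∞ := ENNReal.div_ne_top hy ha0
  have hw0 : 0 ≤ w := ENNReal.toReal_nonneg
  have hyw : y = ENNReal.ofReal w * a := by
    rw [hw, ENNReal.ofReal_toReal hya, ENNReal.div_mul_cancel ha0 ha]
  have hexp : ENNReal.ofReal (Real.exp (w / 32)) ≤ expStepSum a y := by
    rcases Nat.eq_zero_or_eq_succ_pred ⌈w⌉₊ with h | h
    · have : w ≤ 0 := by simpa using h
      refine le_trans ?_ le_self_add
      rw [ENNReal.ofReal_le_one, Real.exp_le_one_iff]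
      linarith
    -- Here `j < w ≤ j + 1`, so the single term of index `j` already dominates `exp (w / 32)`.
    · set j := ⌈w⌉₊.pred
      have hj : (j : ℝ) < w := Nat.lt_ceil.1 (by omega)
      have hj1 : w ≤ (j + 1 : ℝ) := by
        have := Nat.le_ceil w
        rw [h] at this
        exact_mod_cast this
      have hmem : y ∈ ({z | j * a < z} : Set ℝ≥0∞) := by
        change j * a < y
        rw [hyw, ENNReal.mul_lt_mul_iff_left ha0 ha, ← ENNReal.ofReal_natCast]
        exact (ENNReal.ofReal_lt_ofReal_iff_of_nonneg (by positivity)).2 hj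
      calc ENNReal.ofReal (Real.exp (w / 32))
          ≤ ENNReal.ofReal (Real.exp ((j + 1) / 32)) *
            ({z | j * a < z} : Set ℝ≥0∞).indicator 1 y := by
            rw [indicator_of_mem hmem, Pi.one_apply, mul_one]
            gcongr
        _ ≤ _ := ENNReal.le_tsum (f := fun j : ℕ => ENNReal.ofReal (Real.exp ((j + 1) / 32)) *
            ({z | j * a < z} : Set ℝ≥0∞).indicator 1 y) j
        _ ≤ _ := le_add_self
  have h1 : ENNReal.ofReal w ^ s ≤
      ENNReal.ofReal (32 * s) ^ s * ENNReal.ofReal (Real.exp (w / 32)) := by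
    rw [ENNReal.ofReal_rpow_of_nonneg hw0 hs.le, ENNReal.ofReal_rpow_of_nonneg (by positivity) hs.le,
      ← ENNReal.ofReal_mul (by positivity)]
    exact ENNReal.ofReal_le_ofReal (rpow_le_mul_exp hw0 hs)
  calc y ^ s = ENNReal.ofReal w ^ s * a ^ s := by
        conv_lhs => rw [hyw]
        rw [ENNReal.mul_rpow_of_nonneg _ _ hs.le]
    _ ≤ (ENNReal.ofReal (32 * s) ^ s * expStepSum a y) * a ^ s := by
        gcongr
        exact h1.trans (by gcongr)
    _ = _ := by rw [ENNReal.mul_rpow_of_nonneg _ _ hs.le]; ring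

theorem IsLogConcaveProbDensity.exists_moment_bound :
    ∃ C : ℝ≥0, 0 < C ∧ ∀ {k : ℕ} {q g : EuclideanSpace ℝ (Fin k) → ℝ≥0∞},
      IsLogConcaveProbDensity q → Measurable g → (∀ x, g x ≠ ∞) → IsLinearRemez q g →
      ∀ a : ℝ≥0∞, a ≠ ∞ → volume.withDensity q {x | a < g x} ≤ 1 / 4 → ∀ s : ℝ, 1 ≤ s →
        ∫⁻ x, g x ^ s ∂(volume.withDensity q) ≤ (C * ENNReal.ofReal s * a) ^ s := by
  set M : ℝ≥0∞ := 1 + 2 * ENNReal.ofReal (Real.exp (1 / 32)) *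
    ∑' j : ℕ, ENNReal.ofReal (Real.exp (-(1 / 32))) ^ j with hM
  have hMtop : M ≠ ∞ := by
    have h1 : ENNReal.ofReal (Real.exp (-(1 / 32))) < 1 := by
      rw [ENNReal.ofReal_lt_one, Real.exp_lt_one_iff]; norm_num
    exact ENNReal.add_ne_top.2 ⟨by simp, ENNReal.mul_ne_top
      (ENNReal.mul_ne_top (by simp) ENNReal.ofReal_ne_top) (tsum_geometric_lt_top.2 h1).ne⟩
  have hM1 : 1 ≤ M := le_self_add
  refine ⟨32 * M.toNNReal, ?_, ?_⟩
  · have : M.toNNReal ≠ 0 := by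
      rw [Ne, ENNReal.toNNReal_eq_zero_iff]
      simp only [hMtop, or_false]
      exact (lt_of_lt_of_le zero_lt_one hM1).ne'
    positivity
  intro k q g hq hg hgt hR a ha ha4 s hs
  have := hq.isProbabilityMeasure
  set P := volume.withDensity q
  have hs0 : 0 < s := by linarith
  have htail := hq.measure_gt_le hg hR ha ha4
  rcases eq_or_ne a 0 with rfl | ha0
  -- For `a = 0` all the sets in the tail bound coincide with `{g > 0}`, so letting `j → ∞` shows
  -- that it is null.
  · have hz : P {x | 0 < g x} = 0 := by
      have h1 : Tendsto (fun j : ℕ => 2 * ENNReal.ofReal (Real.exp (-(j / 16)))) atTop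
          (𝓝 (2 * ENNReal.ofReal 0)) := by
        refine ENNReal.Tendsto.const_mul (ENNReal.tendsto_ofReal ?_) (Or.inr (by simp))
        refine Real.tendsto_exp_atBot.comp (tendsto_neg_atTop_atBot.comp ?_)
        exact tendsto_natCast_atTop_atTop.atTop_div_const (by norm_num)
      simp only [mul_zero] at htail
      simpa using ge_of_tendsto' h1 htail
    have hae : ∀ᵐ x ∂P, g x ^ s = 0 := by
      have : ∀ᵐ x ∂P, ¬ 0 < g x := by rw [ae_iff]; simpa only [not_not] using hz
      filter_upwards [this] with x hx
      rw [not_lt, nonpos_iff_eq_zero] at hx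
      rw [hx, ENNReal.zero_rpow_of_pos hs0]
    rw [lintegral_congr_ae hae]
    simp
  · have hstep : ∫⁻ x, expStepSum a (g x) ∂P ≤ M := by
      have hm : ∀ j : ℕ, Measurable fun x => ENNReal.ofReal (Real.exp ((j + 1) / 32)) *
          ({z | j * a < z} : Set ℝ≥0∞).indicator 1 (g x) := fun j =>
        ((measurable_one.indicator (measurableSet_lt measurable_const measurable_id)).comp
          hg).const_mul _
      unfold expStepSum
      rw [lintegral_add_left measurable_const, lintegral_tsum fun j => (hm j).aemeasurable, hM,
        ← ENNReal.tsum_mul_left]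
      refine add_le_add (by simp) (ENNReal.tsum_le_tsum fun j => ?_)
      have e1 : ∫⁻ x, ({z | j * a < z} : Set ℝ≥0∞).indicator 1 (g x) ∂P = P {x | j * a < g x} := by
        rw [← lintegral_indicator_one (measurableSet_lt measurable_const hg)]
        rfl
      rw [lintegral_const_mul' _ _ ENNReal.ofReal_ne_top, e1]
      refine (mul_le_mul_right (htail j) _).trans_eq ?_
      rw [← ENNReal.ofReal_pow (Real.exp_pos _).le, mul_left_comm, mul_assoc,
        ← ENNReal.ofReal_mul (Real.exp_pos _).le, ← ENNReal.ofReal_mul (Real.exp_pos _).le,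
        ← Real.exp_nat_mul, ← Real.exp_add, ← Real.exp_add]
      congr 3
      ring
    calc ∫⁻ x, g x ^ s ∂P
        ≤ ∫⁻ x, (ENNReal.ofReal (32 * s) * a) ^ s * expStepSum a (g x) ∂P :=
          lintegral_mono fun x => rpow_le_expStepSum ha ha0 (hgt x) hs0
      _ = (ENNReal.ofReal (32 * s) * a) ^ s * ∫⁻ x, expStepSum a (g x) ∂P :=
          lintegral_const_mul' _ _ (ENNReal.rpow_ne_top_of_nonneg hs0.le
            (ENNReal.mul_ne_top ENNReal.ofReal_ne_top ha))
      -- As `M ≥ 1` and `s ≥ 1`, the factor `M` may be absorbed into the base.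
      _ ≤ (ENNReal.ofReal (32 * s) * a) ^ s * M ^ s := by
          gcongr
          refine hstep.trans ?_
          conv_lhs => rw [← ENNReal.rpow_one M]
          exact ENNReal.rpow_le_rpow_of_exponent_le hM1 hs
      _ = _ := by
          rw [← ENNReal.mul_rpow_of_nonneg _ _ hs0.le, ENNReal.ofReal_mul (by norm_num),
            ENNReal.coe_mul, ENNReal.coe_toNNReal hMtop]
          congr 1
          simp only [ENNReal.ofReal_ofNat, ENNReal.coe_ofNat]
          ring

/-! ### Geometric means from the lower tail -/

/-- The number of integers `j ≥ 0` with `y ≤ 4⁻ʲ a`. -/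
def quarteringCount (a y : ℝ≥0∞) : ℝ≥0∞ :=
  ∑' j : ℕ, ({z | z ≤ 4⁻¹ ^ j * a} : Set ℝ≥0∞).indicator 1 y

theorem IsLogConcaveProbDensity.lintegral_quarteringCount_le (hq : IsLogConcaveProbDensity q)
    (hg : Measurable g) (hR : IsLinearRemez q g) {a : ℝ≥0∞} (ha : a ≠ ∞) (ha0 : a ≠ 0)
    (ha4 : 1 / 4 ≤ volume.withDensity q {x | a ≤ g x}) :
    ∫⁻ x, quarteringCount a (g x) ∂(volume.withDensity q) ≤ 12 := by
  have hm : ∀ j : ℕ, Measurable fun x =>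
      ({z | z ≤ 4⁻¹ ^ j * a} : Set ℝ≥0∞).indicator (1 : ℝ≥0∞ → ℝ≥0∞) (g x) :=
    fun j => (measurable_one.indicator (measurableSet_le measurable_id measurable_const)).comp hg
  unfold quarteringCount
  rw [lintegral_tsum fun j => (hm j).aemeasurable]
  calc _ ≤ ∑' j : ℕ, (6 : ℝ≥0∞) * 2⁻¹ ^ j := by
        refine ENNReal.tsum_le_tsum fun j => ?_
        refine le_of_eq_of_le ?_ (hq.measure_le_le hg hR ha ha0 ha4 j)
        rw [← lintegral_indicator_one (measurableSet_le hg measurable_const)]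
        rfl
    _ = 12 := by rw [ENNReal.tsum_mul_left, ENNReal.tsum_geometric_two]; norm_num

theorem exists_lt_le_quarteringCount {a y : ℝ≥0∞} (ha : a ≠ ∞) (hy : y ≠ 0) :
    ∃ m : ℕ, 4⁻¹ ^ m * a < y ∧ m ≤ quarteringCount a y := by
  classical
  have hex : ∃ m : ℕ, 4⁻¹ ^ m * a < y := by
    have h1 : Tendsto (fun m : ℕ => (4⁻¹ : ℝ≥0∞) ^ m * a) atTop (𝓝 (0 * a)) :=
      ENNReal.Tendsto.mul_const (ENNReal.tendsto_pow_atTop_nhds_zero_of_lt_one (by simp))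
        (Or.inr ha)
    rw [zero_mul] at h1
    exact (h1.eventually (gt_mem_nhds (pos_iff_ne_zero.2 hy))).exists
  refine ⟨Nat.find hex, Nat.find_spec hex, ?_⟩
  refine le_trans ?_ (ENNReal.sum_le_tsum (Finset.range (Nat.find hex)))
  rw [Finset.sum_congr rfl (g := fun _ => (1 : ℝ≥0∞))]
  · simp
  · intro j hj
    have : y ≤ 4⁻¹ ^ j * a := not_lt.1 (Nat.find_min hex (Finset.mem_range.1 hj))
    exact indicator_of_mem (s := ({z | z ≤ 4⁻¹ ^ j * a} : Set ℝ≥0∞)) this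
      (1 : ℝ≥0∞ → ℝ≥0∞)

theorem ofReal_add_ofReal_neg_le {x y z : ℝ} (hz : 0 ≤ z) (h : x ≤ y + z) :
    ENNReal.ofReal x + ENNReal.ofReal (-y) ≤
      ENNReal.ofReal y + ENNReal.ofReal (-x) + ENNReal.ofReal z := by
  have e : ∀ w : ℝ, ENNReal.ofReal w = ENNReal.ofReal (max w 0) := fun w => by simp
  rw [e x, e y, e (-x), e (-y), ← ENNReal.ofReal_add (by simp) (by simp),
    ← ENNReal.ofReal_add (by simp) (by simp), ← ENNReal.ofReal_add (by positivity) hz]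
  refine ENNReal.ofReal_le_ofReal ?_
  have h1 := max_zero_sub_max_neg_zero_eq_self x
  have h2 := max_zero_sub_max_neg_zero_eq_self y
  linarith

/-- The count dominates `log (a / y) / log 4`. Positive and negative parts of the logarithms are
placed so that only sums occur; the inequality can then be integrated before the negative part is
known to be integrable. -/
theorem log_add_le_quarteringCount {a y F A : ℝ≥0∞} {d : ℝ} (hd : 0 < d) (ha : a ≠ ∞)
    (ha0 : a ≠ 0) (hy : y ≠ ∞) (hF : F = y ^ d) (hA : A = a ^ d) :
    (-ENNReal.log F).toENNReal + (ENNReal.log A).toENNReal ≤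
      (ENNReal.log F).toENNReal + (-ENNReal.log A).toENNReal +
        ENNReal.ofReal (d * Real.log 4) * quarteringCount a y := by
  have hd4 : 0 < d * Real.log 4 := mul_pos hd (Real.log_pos (by norm_num))
  rcases eq_or_ne y 0 with rfl | hy0
  · have : quarteringCount a 0 = ∞ := by
      unfold quarteringCount
      simp
    rw [this, ENNReal.mul_top (by simpa using hd4)]
    simp
  obtain ⟨m, hm, hmN⟩ := exists_lt_le_quarteringCount (y := y) ha hy0
  have hyr : 0 < y.toReal := ENNReal.toReal_pos hy0 hy
  have har : 0 < a.toReal := ENNReal.toReal_pos ha0 ha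
  have lF : ENNReal.log F = ((d * Real.log y.toReal : ℝ) : EReal) := by
    rw [hF, ENNReal.log_rpow, ENNReal.log_pos_real hy0 hy, EReal.coe_mul]
  have lA : ENNReal.log A = ((d * Real.log a.toReal : ℝ) : EReal) := by
    rw [hA, ENNReal.log_rpow, ENNReal.log_pos_real ha0 ha, EReal.coe_mul]
  have hlog : Real.log a.toReal ≤ Real.log y.toReal + Real.log 4 * m := by
    have h1 : (4⁻¹ : ℝ) ^ m * a.toReal ≤ y.toReal := by
      simpa using ENNReal.toReal_mono hy hm.le
    have h2 := Real.log_le_log (by positivity) h1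
    rw [Real.log_mul (by positivity) har.ne', Real.log_pow, Real.log_inv] at h2
    linarith
  rw [lF, lA, ← EReal.coe_neg, ← EReal.coe_neg]
  simp only [EReal.real_coe_toENNReal]
  refine le_trans ?_ (add_le_add_right (mul_le_mul_right hmN _) _)
  rw [← ENNReal.ofReal_natCast, ← ENNReal.ofReal_mul hd4.le, add_comm]
  refine ofReal_add_ofReal_neg_le (by positivity) ?_
  calc d * Real.log a.toReal ≤ d * (Real.log y.toReal + Real.log 4 * m) := by gcongr
    _ = _ := by ring

/-- The exponential of the mean of `log F`. -/
def expMeanLog {α : Type*} [MeasurableSpace α] (P : Measure α) (F : α → ℝ≥0∞) : ℝ≥0∞ :=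
  EReal.exp (((∫⁻ x, (ENNReal.log (F x)).toENNReal ∂P : ℝ≥0∞) : EReal) -
    ((∫⁻ x, (-ENNReal.log (F x)).toENNReal ∂P : ℝ≥0∞) : EReal))

theorem exp_sub_eq_ofReal {x y : ℝ≥0∞} (hx : x ≠ ∞) (hy : y ≠ ∞) :
    EReal.exp ((x : EReal) - (y : EReal)) = ENNReal.ofReal (Real.exp (x.toReal - y.toReal)) := by
  rw [← EReal.exp_coe, EReal.coe_sub, EReal.coe_ennreal_toReal hx, EReal.coe_ennreal_toReal hy]

theorem ofReal_log_sub (r : ℝ) :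
    (ENNReal.ofReal r).toReal - (ENNReal.ofReal (-r)).toReal = r := by
  rw [ENNReal.toReal_ofReal', ENNReal.toReal_ofReal', max_zero_sub_max_neg_zero_eq_self]

theorem log_toENNReal_le (y : ℝ≥0∞) : (ENNReal.log y).toENNReal ≤ y := by
  rcases eq_or_ne y 0 with rfl | h0
  · simp
  rcases eq_or_ne y ∞ with rfl | h1
  · simp
  rw [ENNReal.log_pos_real h0 h1, EReal.real_coe_toENNReal]
  refine ENNReal.ofReal_le_of_le_toReal ?_
  linarith [Real.log_le_sub_one_of_pos (ENNReal.toReal_pos h0 h1)]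

theorem log_add_one_le {y m : ℝ≥0∞} (hm : m ≠ ∞) (hm0 : m ≠ 0) :
    (ENNReal.log y).toENNReal + (-ENNReal.log m).toENNReal + 1 ≤
      (-ENNReal.log y).toENNReal + (ENNReal.log m).toENNReal + y / m := by
  rcases eq_or_ne y 0 with rfl | h0
  · simp
  rcases eq_or_ne y ∞ with rfl | h1
  · simp [ENNReal.top_div, hm]
  have hy := ENNReal.toReal_pos h0 h1
  have hmr := ENNReal.toReal_pos hm0 hm
  rw [ENNReal.log_pos_real h0 h1, ENNReal.log_pos_real hm0 hm, ← EReal.coe_neg, ← EReal.coe_neg]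
  simp only [EReal.real_coe_toENNReal]
  have e : y / m = ENNReal.ofReal (y.toReal / m.toReal) := by
    rw [← ENNReal.toReal_div, ENNReal.ofReal_toReal (ENNReal.div_ne_top h1 hm0)]
  have key : Real.log y.toReal + 1 ≤ Real.log m.toReal + y.toReal / m.toReal := by
    have := Real.log_le_sub_one_of_pos (div_pos hy hmr)
    rw [Real.log_div hy.ne' hmr.ne'] at this
    linarith
  have e0 : ∀ w : ℝ, ENNReal.ofReal w = ENNReal.ofReal (max w 0) := fun w => by simp
  rw [e, e0 (Real.log y.toReal), e0 (Real.log m.toReal), e0 (-Real.log y.toReal),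
    e0 (-Real.log m.toReal), ← ENNReal.ofReal_one, ← ENNReal.ofReal_add (by positivity) (by positivity),
    ← ENNReal.ofReal_add (by positivity) (by positivity),
    ← ENNReal.ofReal_add (by positivity) (by positivity),
    ← ENNReal.ofReal_add (by positivity) (by positivity)]
  refine ENNReal.ofReal_le_ofReal ?_
  have h1 := max_zero_sub_max_neg_zero_eq_self (Real.log y.toReal)
  have h2 := max_zero_sub_max_neg_zero_eq_self (Real.log m.toReal)
  linarith

/-- Jensen's inequality, by integrating `log z ≤ z - 1` at `z = F x / m`. -/
theorem expMeanLog_le_lintegral {α : Type*} [MeasurableSpace α] (P : Measure α)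
    [IsProbabilityMeasure P] {F : α → ℝ≥0∞} (hF : Measurable F) :
    expMeanLog P F ≤ ∫⁻ x, F x ∂P := by
  set m := ∫⁻ x, F x ∂P with hm
  rcases eq_or_ne m ∞ with h1 | h1
  · rw [h1]; exact le_top
  unfold expMeanLog
  have hLp : ∫⁻ x, (ENNReal.log (F x)).toENNReal ∂P ≠ ∞ :=
    ne_top_of_le_ne_top h1 (lintegral_mono fun x => log_toENNReal_le _)
  rcases eq_or_ne (∫⁻ x, (-ENNReal.log (F x)).toENNReal ∂P) ∞ with h2 | h2
  · rw [h2]; simp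
  rw [exp_sub_eq_ofReal hLp h2]
  have hmeas : Measurable fun x => (-ENNReal.log (F x)).toENNReal :=
    (hF.ennreal_log.neg).ereal_toENNReal
  rcases eq_or_ne m 0 with h0 | h0
  · rw [hm, lintegral_eq_zero_iff hF] at h0
    refine absurd ?_ h2
    rw [lintegral_congr_ae (g := fun _ => ∞) (by filter_upwards [h0] with x hx; simp [hx])]
    simp
  have key := lintegral_mono (μ := P) fun x => log_add_one_le (y := F x) h1 h0
  rw [lintegral_add_right _ measurable_const, lintegral_add_right _ measurable_const,
    lintegral_add_right _ (hF.div_const m), lintegral_add_right _ measurable_const] at key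
  simp only [lintegral_const, measure_univ, mul_one, div_eq_mul_inv,
    lintegral_mul_const _ hF, ← hm, ENNReal.mul_inv_cancel h0 h1] at key
  rw [ENNReal.add_le_add_iff_right ENNReal.one_ne_top, ENNReal.log_pos_real h0 h1,
    ← EReal.coe_neg] at key
  simp only [EReal.real_coe_toENNReal] at key
  have k2 := ENNReal.toReal_mono (ENNReal.add_ne_top.2 ⟨h2, ENNReal.ofReal_ne_top⟩) key
  rw [ENNReal.toReal_add hLp ENNReal.ofReal_ne_top, ENNReal.toReal_add h2 ENNReal.ofReal_ne_top]
    at k2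
  have k3 := ofReal_log_sub (Real.log m.toReal)
  refine ENNReal.ofReal_le_of_le_toReal ?_
  rw [← Real.le_log_iff_exp_le (ENNReal.toReal_pos h0 h1)]
  linarith

/-- Integrating `log_add_le_quarteringCount`, with the mean count at most `12`, produces the factor
`4 ^ (12 d)`. The hypothesis `hlog` excludes `∞ - ∞`. -/
theorem IsLogConcaveProbDensity.rpow_le_expMeanLog (hq : IsLogConcaveProbDensity q)
    (hg : Measurable g) (hgt : ∀ x, g x ≠ ∞) (hR : IsLinearRemez q g) {a : ℝ≥0∞} (ha : a ≠ ∞)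
    (ha4 : 1 / 4 ≤ volume.withDensity q {x | a ≤ g x}) {d : ℝ} (hd : 0 < d)
    (hlog : ∫⁻ x, (ENNReal.log (g x ^ d)).toENNReal ∂(volume.withDensity q) ≠ ∞) :
    a ^ d ≤ (4 ^ 12) ^ d * expMeanLog (volume.withDensity q) (fun x => g x ^ d) := by
  have := hq.isProbabilityMeasure
  set P := volume.withDensity q
  rcases eq_or_ne a 0 with rfl | ha0
  · simp [hd]
  have hF : Measurable fun x => g x ^ d := hg.pow_const d
  have key := lintegral_mono (μ := P) fun x =>
    log_add_le_quarteringCount hd ha ha0 (hgt x) (rfl : g x ^ d = _) (rfl : a ^ d = _)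
  have hmeas : Measurable fun x => (ENNReal.log (g x ^ d)).toENNReal :=
    hF.ennreal_log.ereal_toENNReal
  have har : 0 < a.toReal := ENNReal.toReal_pos ha0 ha
  have lA : ENNReal.log (a ^ d) = ((d * Real.log a.toReal : ℝ) : EReal) := by
    rw [ENNReal.log_rpow, ENNReal.log_pos_real ha0 ha, EReal.coe_mul]
  rw [lintegral_add_right _ measurable_const,
    lintegral_add_left (by exact hmeas.add measurable_const),
    lintegral_add_right _ measurable_const, lintegral_const_mul' _ _ ENNReal.ofReal_ne_top] at key
  rw [lA, ← EReal.coe_neg] at key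
  simp only [lintegral_const, measure_univ, mul_one, EReal.real_coe_toENNReal] at key
  have hN := hq.lintegral_quarteringCount_le hg hR ha ha0 ha4
  have key2 := key.trans (add_le_add_right (mul_le_mul_right hN _) _)
  have hfin : ∫⁻ x, (ENNReal.log (g x ^ d)).toENNReal ∂P +
      ENNReal.ofReal (-(d * Real.log a.toReal)) + ENNReal.ofReal (d * Real.log 4) * 12 ≠ ∞ :=
    ENNReal.add_ne_top.2 ⟨ENNReal.add_ne_top.2 ⟨hlog, ENNReal.ofReal_ne_top⟩,
      ENNReal.mul_ne_top ENNReal.ofReal_ne_top (by simp)⟩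
  have hneg : ∫⁻ x, (-ENNReal.log (g x ^ d)).toENNReal ∂P ≠ ∞ :=
    ne_top_of_le_ne_top hfin (le_self_add.trans key2)
  have key3 := ENNReal.toReal_mono hfin key2
  have hd4 : 0 < d * Real.log 4 := mul_pos hd (Real.log_pos (by norm_num))
  rw [ENNReal.toReal_add hneg ENNReal.ofReal_ne_top, ENNReal.toReal_add
    (ENNReal.add_ne_top.2 ⟨hlog, ENNReal.ofReal_ne_top⟩)
      (ENNReal.mul_ne_top ENNReal.ofReal_ne_top (by simp)),
    ENNReal.toReal_add hlog ENNReal.ofReal_ne_top, ENNReal.toReal_mul,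
    ENNReal.toReal_ofReal hd4.le] at key3
  have k3 := ofReal_log_sub (d * Real.log a.toReal)
  unfold expMeanLog
  rw [exp_sub_eq_ofReal hlog hneg]
  set Lp := (∫⁻ x, (ENNReal.log (g x ^ d)).toENNReal ∂P).toReal
  set Ln := (∫⁻ x, (-ENNReal.log (g x ^ d)).toENNReal ∂P).toReal
  have e12 : (12 : ℝ≥0∞).toReal = 12 := by simp
  rw [e12] at key3
  have e1 : a ^ d = ENNReal.ofReal (Real.exp (d * Real.log a.toReal)) := by
    conv_lhs => rw [← ENNReal.ofReal_toReal ha]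
    rw [ENNReal.ofReal_rpow_of_pos har, Real.rpow_def_of_pos har, mul_comm]
  have e2 : ((4 : ℝ≥0∞) ^ 12) ^ d = ENNReal.ofReal (Real.exp (d * Real.log 4 * 12)) := by
    have : (4 : ℝ≥0∞) ^ 12 = ENNReal.ofReal (4 ^ 12) := by
      rw [ENNReal.ofReal_pow (by norm_num)]; simp
    rw [this, ENNReal.ofReal_rpow_of_pos (by positivity), Real.rpow_def_of_pos (by positivity),
      Real.log_pow]
    congr 2
    push_cast
    ring
  rw [e1, e2, ← ENNReal.ofReal_mul (Real.exp_pos _).le, ← Real.exp_add]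
  exact ENNReal.ofReal_le_ofReal (Real.exp_le_exp.2 (by linarith))

/-! ### Remez exponents and normalization of the density -/

theorem IsRemezExponent.mono {n : ℕ} {f : EuclideanSpace ℂ (Fin n) → ℂ} {d d' : ℝ≥0}
    (hf : IsRemezExponent f d) (h : d ≤ d') : IsRemezExponent f d' := by
  intro a ha b hb E hE hEm hE0
  refine (hf a ha b hb E hE hEm hE0).trans (mul_le_mul_left ?_ _)
  refine ENNReal.rpow_le_rpow_of_exponent_le ?_ (by exact_mod_cast h)
  have h1 : volume E ≤ 1 := (measure_mono hE).trans (by simp)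
  rw [ENNReal.le_div_iff_mul_le (Or.inl hE0) (Or.inr (by simp)), one_mul]
  exact h1.trans (by norm_num)

theorem isRemezExponent_of_chebyshevDegree_lt {n : ℕ} {f : EuclideanSpace ℂ (Fin n) → ℂ}
    {d : ℝ≥0} (h : chebyshevDegree f < d) : IsRemezExponent f d := by
  unfold chebyshevDegree at h
  simp only [iInf_lt_iff] at h
  obtain ⟨d', hd', hlt⟩ := h
  exact hd'.mono (by exact_mod_cast hlt.le)

/-- The Remez inequality for the sublevel set `E` on the segment from `x` to `y`: `F x` is the value
at `t = 0`, and a `d`-th root makes the bound linear. -/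
theorem IsRemezExponent.isLinearRemez {k n : ℕ} {f : EuclideanSpace ℂ (Fin n) → ℂ} {d : ℝ≥0}
    (hf : IsRemezExponent f d) (hd : 0 < d)
    {ι : EuclideanSpace ℝ (Fin k) →ᵃⁱ[ℝ] EuclideanSpace ℂ (Fin n)}
    {V : Set (EuclideanSpace ℝ (Fin k))} (hV : Convex ℝ V) (hVι : ι '' V ⊆ Metric.ball 0 1)
    {q F : EuclideanSpace ℝ (Fin k) → ℝ≥0∞} (hqV : ∀ x, q x ≠ 0 → x ∈ V) (hF : Measurable F)
    (hFf : ∀ x ∈ V, F x = ‖f (ι x)‖ₑ) : IsLinearRemez q fun x => F x ^ (d : ℝ)⁻¹ := by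
  intro x y hx hy b
  have hd' : (0 : ℝ) < d := by exact_mod_cast hd
  have hxV := hqV x hx
  have hyV := hqV y hy
  set E : Set ℝ := {t ∈ Icc (0 : ℝ) 1 | F ((1 - t) • x + t • y) ^ (d : ℝ)⁻¹ ≤ b} with hE
  have hEm : MeasurableSet E := by
    have hm : Measurable fun t : ℝ => F ((1 - t) • x + t • y) ^ (d : ℝ)⁻¹ :=
      (hF.comp (by fun_prop : Measurable fun t : ℝ => (1 - t) • x + t • y)).pow_const _
    exact measurableSet_Icc.inter (measurableSet_le hm measurable_const)
  rcases eq_or_ne (volume E) 0 with h0 | h0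
  · simp [h0]
  have hEtop : volume E ≠ ∞ :=
    ne_top_of_le_ne_top (b := volume (Icc (0 : ℝ) 1)) (by simp) (measure_mono fun t ht => ht.1)
  have hline : ∀ t ∈ Icc (0 : ℝ) 1,
      ‖f (AffineMap.lineMap (ι x) (ι y) t)‖ₑ = F ((1 - t) • x + t • y) := fun t ht => by
    have hz : (1 - t) • x + t • y ∈ V :=
      hV hxV hyV (sub_nonneg.2 ht.2) ht.1 (by ring)
    rw [hFf _ hz, ← AffineMap.lineMap_apply_module]
    congr 2
    exact (ι.toAffineMap.apply_lineMap x y t).symm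
  have key := hf (ι x) (hVι ⟨x, hxV, rfl⟩) (ι y) (hVι ⟨y, hyV, rfl⟩) E (fun t ht => ht.1) hEm h0
  have h1 : F x ≤ ⨆ t ∈ Icc (0 : ℝ) 1, ‖f (AffineMap.lineMap (ι x) (ι y) t)‖ₑ := by
    refine le_trans (le_of_eq ?_) (le_iSup₂ (0 : ℝ) (left_mem_Icc.2 zero_le_one))
    rw [AffineMap.lineMap_apply_zero, hFf x hxV]
  have h2 : ⨆ t ∈ E, ‖f (AffineMap.lineMap (ι x) (ι y) t)‖ₑ ≤ b ^ (d : ℝ) := by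
    refine iSup₂_le fun t ht => ?_
    rw [hline t ht.1]
    exact (ENNReal.rpow_inv_le_iff hd').1 ht.2
  have h3 : F x ≤ (4 / volume E * b) ^ (d : ℝ) := by
    rw [ENNReal.mul_rpow_of_nonneg _ _ hd'.le]
    exact h1.trans (key.trans (mul_le_mul_right h2 _))
  calc F x ^ (d : ℝ)⁻¹ * volume E ≤ 4 / volume E * b * volume E :=
        mul_le_mul_left ((ENNReal.rpow_inv_le_iff hd').2 h3) _
    _ = 4 * b := by rw [mul_right_comm, ENNReal.div_mul_cancel h0 hEtop]

/-- `h` need not be measurable on the frontier of its support `K`. Cutting it off to `interior K`,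
where a concave function is continuous, changes it only on a null set since `K` is convex, and keeps
log-concavity. -/
theorem IsLogConcave.exists_isLogConcaveProbDensity {k : ℕ}
    {h : EuclideanSpace ℝ (Fin k) → ℝ≥0} (hh : IsLogConcave h)
    {V : Set (EuclideanSpace ℝ (Fin k))} (hVm : MeasurableSet V) (hV : ∀ x, x ∉ V → h x = 0)
    (h0 : densityMeasure h V ≠ 0) (h1 : densityMeasure h V ≠ ∞) :
    ∃ q : EuclideanSpace ℝ (Fin k) → ℝ≥0∞, IsLogConcaveProbDensity q ∧ (∀ x, q x ≠ 0 → x ∈ V) ∧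
      (((densityMeasure h).restrict V univ)⁻¹ • (densityMeasure h).restrict V) =
        volume.withDensity q := by
  set K : Set (EuclideanSpace ℝ (Fin k)) := {x | 0 < h x} with hK
  have hKc : Convex ℝ K := hh.1
  set M := densityMeasure h V with hM
  set h₀ : EuclideanSpace ℝ (Fin k) → ℝ≥0∞ := (interior K).indicator fun x => (h x : ℝ≥0∞) with hh₀
  have hpos : ∀ x ∈ interior K, 0 < h x := fun x hx =>
    (interior_subset hx : x ∈ K)
  have hm₀ : Measurable h₀ := by
    have hc : ContinuousOn (fun x => ENNReal.ofReal (Real.exp (Real.log (h x)))) (interior K) :=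
      ENNReal.continuous_ofReal.comp_continuousOn
        (Real.continuous_exp.comp_continuousOn (ConcaveOn.continuousOn_interior hh))
    have hc' : ContinuousOn (fun x => (h x : ℝ≥0∞)) (interior K) := by
      refine hc.congr fun x hx => ?_
      dsimp only
      rw [Real.exp_log (by exact_mod_cast hpos x hx), ENNReal.ofReal_coe_nnreal]
    classical
    rw [hh₀, ← Set.piecewise_eq_indicator]
    exact hc'.measurable_piecewise continuousOn_const isOpen_interior.measurableSet
  have hae : (fun x => (h x : ℝ≥0∞)) =ᵐ[volume] h₀ := by
    have hfr : ∀ᵐ x ∂(volume : Measure (EuclideanSpace ℝ (Fin k))), x ∉ frontier K :=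
      measure_eq_zero_iff_ae_notMem.1 (hKc.addHaar_frontier volume)
    filter_upwards [hfr] with x hx
    by_cases hxi : x ∈ interior K
    · rw [hh₀, indicator_of_mem hxi]
    · rw [hh₀, indicator_of_notMem hxi]
      have hxK : x ∉ K := fun hxK => hx ⟨subset_closure hxK, hxi⟩
      have : h x = 0 := by simpa [hK] using hxK
      simp [this]
  have hμ : densityMeasure h = volume.withDensity h₀ := withDensity_congr_ae hae
  have hsupp : ∀ x, h₀ x ≠ 0 → x ∈ interior K := fun x hx => by
    by_contra hxi
    exact hx (by rw [hh₀, indicator_of_notMem hxi])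
  have hKV : K ⊆ V := fun x hx => by
    by_contra hxV
    exact (ne_of_gt hx) (hV x hxV)
  have hres : (densityMeasure h).restrict V = densityMeasure h := by
    rw [hμ, restrict_withDensity hVm, ← withDensity_indicator hVm]
    congr 1
    refine indicator_eq_self.2 fun x hx => hKV (interior_subset (hsupp x hx))
  have hMi0 : M⁻¹ ≠ 0 := ENNReal.inv_ne_zero.2 h1
  have hMi1 : M⁻¹ ≠ ∞ := ENNReal.inv_ne_top.2 h0
  have hPeq : ((densityMeasure h).restrict V univ)⁻¹ • (densityMeasure h).restrict V =
      volume.withDensity (M⁻¹ • h₀) := by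
    rw [withDensity_smul _ hm₀, ← hμ, Measure.restrict_apply_univ, hres]
  refine ⟨M⁻¹ • h₀, ⟨hm₀.const_smul _, fun x => ?_, ?_, ?_⟩, fun x hx => ?_, hPeq⟩
  · refine ENNReal.mul_ne_top hMi1 ?_
    by_cases hx : x ∈ interior K <;> simp [hh₀, hx]
  · have := congrArg (fun m : Measure _ => m univ) hPeq
    simp only [Measure.smul_apply, smul_eq_mul, withDensity_apply _ MeasurableSet.univ,
      Measure.restrict_univ, Measure.restrict_apply_univ] at this
    rw [← this, ← hM, ENNReal.inv_mul_cancel h0 h1]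
  · intro x y t ht
    -- The endpoints are separate because `0 ^ 0 = 1`; for `0 < t < 1` a vanishing factor kills the
    -- left side.
    rcases eq_or_lt_of_le ht.1 with rfl | t0
    · simp
    rcases eq_or_lt_of_le ht.2 with rfl | t1
    · simp
    have t1' : 0 < 1 - t := sub_pos.2 t1
    by_cases hx : x ∈ interior K
    swap
    · simp [hh₀, hx, t1']
    by_cases hy : y ∈ interior K
    swap
    · simp [hh₀, hy, t0]
    have hz : (1 - t) • x + t • y ∈ interior K :=
      hKc.interior hx hy t1'.le t0.le (by ring)
    simp only [Pi.smul_apply, smul_eq_mul, hh₀, indicator_of_mem hx, indicator_of_mem hy,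
      indicator_of_mem hz]
    rw [ENNReal.mul_rpow_of_nonneg _ _ t1'.le, ENNReal.mul_rpow_of_nonneg _ _ t0.le,
      mul_mul_mul_comm, ← ENNReal.rpow_add _ _ hMi0 hMi1, sub_add_cancel, ENNReal.rpow_one]
    gcongr
    have hx' : (0 : ℝ) < h x := by exact_mod_cast hpos x hx
    have hy' : (0 : ℝ) < h y := by exact_mod_cast hpos y hy
    have hz' : (0 : ℝ) < h ((1 - t) • x + t • y) := by exact_mod_cast hpos _ hz
    have hc := hh.2 (hpos x hx) (hpos y hy) t1'.le t0.le (by ring)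
    rw [← ENNReal.coe_rpow_of_nonneg _ t1'.le, ← ENNReal.coe_rpow_of_nonneg _ t0.le,
      ← ENNReal.coe_mul, ENNReal.coe_le_coe, ← NNReal.coe_le_coe]
    push_cast
    rw [Real.rpow_def_of_pos hx', Real.rpow_def_of_pos hy', ← Real.exp_add,
      ← Real.le_log_iff_exp_le hz']
    simp only [smul_eq_mul] at hc
    linarith
  · refine hKV (interior_subset (hsupp x ?_))
    rintro h
    simp [h] at hx

/-! ### Reverse Jensen inequality and conclusion -/

theorem IsLogConcaveProbDensity.exists_reverse_jensen :
    ∃ c : ℝ≥0, 0 < c ∧ ∀ {k : ℕ} {q F : EuclideanSpace ℝ (Fin k) → ℝ≥0∞},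
      IsLogConcaveProbDensity q → Measurable F → ∀ B : ℝ≥0∞, B ≠ ∞ → (∀ x, F x ≤ B) →
      ∀ p d : ℝ≥0, 0 < p → 0 < d → IsLinearRemez q (fun x => F x ^ (d : ℝ)⁻¹) →
        ∫⁻ x, F x ^ (p : ℝ) ∂(volume.withDensity q) ≤
          (((c * max 1 (p * d)) ^ ((p * d : ℝ≥0) : ℝ) : ℝ≥0) : ℝ≥0∞) *
            expMeanLog (volume.withDensity q) F ^ (p : ℝ) := by
  obtain ⟨C, hC, H⟩ := IsLogConcaveProbDensity.exists_moment_bound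
  refine ⟨C * 4 ^ 12, by positivity, ?_⟩
  intro k q F hq hF B hB hFB p d hp hd hR
  have := hq.isProbabilityMeasure
  set P := volume.withDensity q with hP
  set g : EuclideanSpace ℝ (Fin k) → ℝ≥0∞ := fun x => F x ^ (d : ℝ)⁻¹ with hg
  have hd' : (0 : ℝ) < d := by exact_mod_cast hd
  have hp' : (0 : ℝ) < p := by exact_mod_cast hp
  have hpd : (0 : ℝ) < ((p * d : ℝ≥0) : ℝ) := by exact_mod_cast mul_pos hp hd
  have hgm : Measurable g := hF.pow_const _
  have hgt : ∀ x, g x ≠ ∞ := fun x =>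
    ENNReal.rpow_ne_top_of_nonneg (by positivity) (ne_top_of_le_ne_top hB (hFB x))
  have hgd : (fun x => g x ^ (d : ℝ)) = F := by
    ext x
    rw [hg, ← ENNReal.rpow_mul, inv_mul_cancel₀ hd'.ne', ENNReal.rpow_one]
  obtain ⟨a, ha, ha4, ha4'⟩ := exists_upper_quartile P hgm hgt
  -- The moment bound requires `s ≥ 1`; monotonicity of `L^s` norms on a probability space then
  -- descends to the exponent `p * d`.
  set s : ℝ≥0 := max 1 (p * d) with hs
  have hs1 : (1 : ℝ) ≤ s := by exact_mod_cast le_max_left 1 (p * d)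
  have hspd : ((p * d : ℝ≥0) : ℝ) ≤ s := by exact_mod_cast le_max_right 1 (p * d)
  have hmom := H hq hgm hgt hR a ha ha4 s hs1
  have hlog : ∫⁻ x, (ENNReal.log (g x ^ (d : ℝ))).toENNReal ∂P ≠ ∞ := by
    refine ne_top_of_le_ne_top hB ?_
    calc _ ≤ ∫⁻ _x, B ∂P := lintegral_mono fun x => by
          refine (log_toENNReal_le _).trans ?_
          rw [congrFun hgd x]
          exact hFB x
      _ = B := by simp
  have hlow := hq.rpow_le_expMeanLog hgm hgt hR ha ha4' hd' hlog
  rw [hgd] at hlow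
  have hnorm := eLpNorm'_le_eLpNorm'_of_exponent_le (f := g) hpd hspd P
    hgm.aestronglyMeasurable
  have hup : ∫⁻ x, F x ^ (p : ℝ) ∂P ≤ (C * s * a) ^ ((p * d : ℝ≥0) : ℝ) := by
    have e1 : ∫⁻ x, F x ^ (p : ℝ) ∂P = ∫⁻ x, g x ^ ((p * d : ℝ≥0) : ℝ) ∂P := by
      refine lintegral_congr fun x => ?_
      rw [hg, ← ENNReal.rpow_mul]
      congr 1
      push_cast
      field_simp
    have e2 : (∫⁻ x, g x ^ (s : ℝ) ∂P) ^ (s : ℝ)⁻¹ ≤ C * s * a := by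
      rw [ENNReal.rpow_inv_le_iff (by linarith)]
      simpa using hmom
    rw [e1, ← ENNReal.rpow_inv_le_iff hpd]
    refine le_trans ?_ e2
    simpa [eLpNorm', one_div] using hnorm
  have e3 : ∀ y : ℝ≥0∞, y ^ ((p * d : ℝ≥0) : ℝ) = (y ^ (d : ℝ)) ^ (p : ℝ) := fun y => by
    rw [← ENNReal.rpow_mul, NNReal.coe_mul, mul_comm]
  calc ∫⁻ x, F x ^ (p : ℝ) ∂P ≤ (C * s * a) ^ ((p * d : ℝ≥0) : ℝ) := hup
    _ = (C * s : ℝ≥0∞) ^ ((p * d : ℝ≥0) : ℝ) * (a ^ (d : ℝ)) ^ (p : ℝ) := by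
        rw [ENNReal.mul_rpow_of_nonneg _ _ hpd.le, e3 a]
    _ ≤ (C * s : ℝ≥0∞) ^ ((p * d : ℝ≥0) : ℝ) * ((4 ^ 12) ^ (d : ℝ) * expMeanLog P F) ^ (p : ℝ) := by
        gcongr
    _ = ((C * s : ℝ≥0∞) * 4 ^ 12) ^ ((p * d : ℝ≥0) : ℝ) * expMeanLog P F ^ (p : ℝ) := by
        rw [ENNReal.mul_rpow_of_nonneg _ _ hp'.le, ← e3, ← mul_assoc,
          ← ENNReal.mul_rpow_of_nonneg _ _ hpd.le]
    _ = _ := by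
        rw [ENNReal.coe_rpow_of_nonneg _ hpd.le]
        push_cast
        ring_nf

theorem tendsto_growth_constant {c : ℝ≥0} (hc : 0 < c) (p d : ℝ≥0) :
    Tendsto (fun d' : ℝ≥0 =>
      (((c * max 1 (p * d')) ^ ((p * d' : ℝ≥0) : ℝ) : ℝ≥0) : ℝ≥0∞)) (𝓝[>] d)
      (𝓝 (((c * max 1 (p * d)) ^ ((p * d : ℝ≥0) : ℝ) : ℝ≥0) : ℝ≥0∞)) := by
  refine ENNReal.tendsto_coe.2 (Tendsto.mono_left ?_ nhdsWithin_le_nhds)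
  have hpos : c * max 1 (p * d) ≠ 0 :=
    (mul_pos hc (lt_of_lt_of_le one_pos (le_max_left _ _))).ne'
  have h1 : Continuous fun d' : ℝ≥0 => c * max 1 (p * d') := by fun_prop
  have h2 : Continuous fun d' : ℝ≥0 => ((p * d' : ℝ≥0) : ℝ) := by fun_prop
  exact (NNReal.continuousAt_rpow (x := c * max 1 (p * d)) (Or.inl hpos)).tendsto.comp
    (h1.continuousAt.prodMk_nhds h2.continuousAt)

end

theorem corollaryc1 :
    ∃ c : ℝ≥0, 0 < c ∧
      ∀ (k n : ℕ) (ι : EuclideanSpace ℝ (Fin k) →ᵃⁱ[ℝ] EuclideanSpace ℂ (Fin n))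
        (V : Set (EuclideanSpace ℝ (Fin k))) (h : EuclideanSpace ℝ (Fin k) → ℝ≥0)
        (r : ℝ) (f : EuclideanSpace ℂ (Fin n) → ℂ) (p d : ℝ≥0),
        Convex ℝ V → IsCompact V → (interior V).Nonempty →
        ι '' V ⊆ Metric.ball 0 1 →
        IsLogConcave h → (∀ x, x ∉ V → h x = 0) →
        densityMeasure h V ≠ 0 → densityMeasure h V ≠ ∞ →
        1 < r → DifferentiableOn ℂ f (Metric.ball 0 r) →
        1 < p → chebyshevDegree f ≤ d →
        (⨍⁻ x in V, ‖f (ι x)‖ₑ ^ (p : ℝ) ∂(densityMeasure h) ≤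
          (((c * max 1 (p * d)) ^ ((p * d : ℝ≥0) : ℝ) : ℝ≥0) : ℝ≥0∞) *
            geomMean (densityMeasure h) V (fun x => f (ι x)) ^ (p : ℝ)) ∧
        ((((c * max 1 (p * d)) ^ ((p * d : ℝ≥0) : ℝ) : ℝ≥0) : ℝ≥0∞) *
            geomMean (densityMeasure h) V (fun x => f (ι x)) ^ (p : ℝ) ≤
          (((c * max 1 (p * d)) ^ ((p * d : ℝ≥0) : ℝ) : ℝ≥0) : ℝ≥0∞) *
            (⨍⁻ x in V, ‖f (ι x)‖ₑ ∂(densityMeasure h)) ^ (p : ℝ)) := by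
  obtain ⟨c, hc, H⟩ := IsLogConcaveProbDensity.exists_reverse_jensen
  refine ⟨c, hc, ?_⟩
  intro k n ι V h r f p d hVc hVk _ hVι hh hhV h0 h1 hr hf hp hfd
  have hVm : MeasurableSet V := hVk.measurableSet
  obtain ⟨q, hq, hqV, hP⟩ := hh.exists_isLogConcaveProbDensity hVm hhV h0 h1
  have := hq.isProbabilityMeasure
  have hcont : ContinuousOn (fun x => f (ι x)) V := by
    refine hf.continuousOn.comp ι.continuous.continuousOn fun x hx => ?_
    exact Metric.ball_subset_ball hr.le (hVι ⟨x, hx, rfl⟩)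
  -- Off `V` nothing ensures that `f ∘ ι` is measurable or bounded, so it is cut off.
  set F : EuclideanSpace ℝ (Fin k) → ℝ≥0∞ := V.indicator fun x => ‖f (ι x)‖ₑ with hFdef
  have hFV : ∀ x ∈ V, F x = ‖f (ι x)‖ₑ := fun x hx => indicator_of_mem hx _
  have hFm : Measurable F := by
    classical
    rw [hFdef, ← Set.piecewise_eq_indicator]
    exact hcont.enorm.measurable_piecewise continuousOn_const hVm
  obtain ⟨b, hb⟩ := hVk.exists_bound_of_continuousOn hcont
  have hFB : ∀ x, F x ≤ ENNReal.ofReal b := fun x => by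
    by_cases hx : x ∈ V
    · rw [hFV x hx, ← ofReal_norm]
      exact ENNReal.ofReal_le_ofReal (hb x hx)
    · rw [hFdef, indicator_of_notMem hx]; exact zero_le
  have havg : ∀ Φ : ℝ≥0∞ → ℝ≥0∞, ⨍⁻ x in V, Φ ‖f (ι x)‖ₑ ∂(densityMeasure h) =
      ∫⁻ x, Φ (F x) ∂(volume.withDensity q) := fun Φ => by
    rw [← hP, lintegral_smul_measure, laverage_eq', lintegral_smul_measure]
    congr 1
    exact setLIntegral_congr_fun hVm fun x hx => by simp only [hFV x hx]
  have hgeom : geomMean (densityMeasure h) V (fun x => f (ι x)) =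
      expMeanLog (volume.withDensity q) F := by
    unfold geomMean expMeanLog
    rw [havg fun y => (ENNReal.log y).toENNReal, havg fun y => (-ENNReal.log y).toENNReal]
  rw [havg fun y => y ^ (p : ℝ), havg fun y => y, hgeom]
  constructor
  -- Every `d' > d` is a positive Remez exponent; letting `d' ↓ d` covers `d = 0` and avoids asking
  -- whether the infimum is attained.
  · refine ge_of_tendsto (ENNReal.Tendsto.mul_const (tendsto_growth_constant hc p d) (Or.inl ?_)) ?_
    · exact ENNReal.coe_ne_zero.2 (NNReal.rpow_pos (mul_pos hc
        (lt_of_lt_of_le one_pos (le_max_left _ _)))).ne'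
    · filter_upwards [self_mem_nhdsWithin] with d' hd'
      have hd0 : 0 < d' := lt_of_le_of_lt zero_le hd'
      have hrem : IsRemezExponent f d' := isRemezExponent_of_chebyshevDegree_lt
        (hfd.trans_lt (by exact_mod_cast hd'))
      exact H hq hFm _ ENNReal.ofReal_ne_top hFB p d' (one_pos.trans hp) hd0
        (hrem.isLinearRemez hd0 hVc hVι hqV hFm hFV)
  · gcongr
    exact expMeanLog_le_lintegral _ hFm
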